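/- **Setting.** For $n=1,2,\dots$ consider $N=N_n\to\infty$ qubits on a line and a random Hamiltonian $H=\sum_i E_i|E_i\rangle\langle E_i|$ with given real energies $E_i$ and a random orthonormal eigenbasis $(|E_i\rangle)$. (All objects below depend on $n$, except the constants $\beta>0$, $c$ and $\lambda$.) An operator is $d$-local if it acts on at most $d$ consecutive qubits; an observable is a Hermitian operator. *Shell and entropy.* Fix a microcanonical shell $[E-\Delta,E+\Delta]$ and let $S=\ln\#\{i: |E_i-E|\le\Delta\}$ be its microcanonical entropy. Assume that $S$ is extensive, i.e. $N=O(S)$, and that the width of the shell is subextensive, $\Delta=o(N)$. *ETH.* For every $d$-local observable $A$ with $\|A\|\le 1$ there are smooth functions $\mathcal A(E)$, $f(E,\omega)$ such that for all eigenstates in the shell $$\langle E_i|A|E_j\rangle=\mathcal A(E)\,\delta_{ij}+e^{-S/2}f(E,\omega_{ij})R_{ij},\qquad \omega_{ij}=E_i-E_j,$$ with random variables $R_{ij}$ of zero mean and unit variance, and $|f(E,\omega)|\le c\,e^{-\beta|\omega|/4}$ for all $\omega$, with $c$ independent of $A$ and $n$. *Lyapunov exponent.* With $\rho=e^{-\beta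 H}/\operatorname{Tr}e^{-\beta H}$, $A(t)=e^{iHt}Ae^{-iHt}$ and a $d$-local observable $A=A_n$, let $F_2(t)$ and $F_{\rm OTO}(t)$ be the ensemble averages of $\operatorname{Tr}[\rho^{1/2}A(t)\rho^{1/2}A]$ and $\operatorname{Tr}[\rho^{1/4}A(t)\rho^{1/4}A\rho^{1/4}A(t)\rho^{1/4}A]$. The number $\lambda$ is the Lyapunov exponent: there are dissipation times $t_d$, bounded below by a positive constant, scrambling times $t_s$ with $t_d=o(t_s)$, and constants $C\neq 0$ (all depending on $n$) such that for all times $t=t_n>0$ with $t_d\ll t\ll t_s$ (i.e. $t_d=o(t)$, $t=o(t_s)$) one has $F_2(t)/F_2(0)\to0$ and $F_{\rm OTO}(t)=C\,(1-(1+o(1))e^{\lambda(t-t_s)})$. Assume that the chaos bound is saturated, $\lambda=2\pi/\beta$. *Code.* Let $\mathcal C$ be spanned by $2^k$ of the eigenstates in the shell (chosen by fixed labels). Its error $\varepsilon_{\rm code}$ is the smallest $\varepsilon\ge0$ for which it is an $[[N,k,d,\varepsilon]]$ approximate quantum error-correcting code: for every channel $\Lambda$ acting on at most $d$ consecutive qubits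 and every unit vector $\psi\in\mathcal C\otimes\mathbb C^{2^k}$ there is a decoding channel $\mathcal D$ with $\langle\psi|(\mathcal D\circ\Lambda\otimes I)(|\psi\rangle\langle\psi|)|\psi\rangle\ge1-\varepsilon$. **Theorem.** With probability tending to $1$ as $n\to\infty$ the following holds: if $\varepsilon_{\rm code}>0$, then for every energy difference $\omega=E_i-E_j$ of eigenstates spanning $\mathcal C$, $$2\ln\frac{2^{d+2k}}{\varepsilon_{\rm code}}-\frac S2>0\qquad\text{and}\qquad \lambda\ \ge\ \frac{\pi|\omega|}{2\ln\left(\frac{2^{d+2k}}{\varepsilon_{\rm code}}\right)-\frac S2}.$$ -/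

import Mathlib

open Matrix MeasureTheory Filter Topology Asymptotics
open scoped Kronecker

namespace ChaosCode

noncomputable section

/-! ### Qubits on a line -/

/-- Labels of the computational basis of `N` qubits. -/
abbrev Conf (N : ℕ) : Type := Fin N → Fin 2

/-- Operators on the `2 ^ N`-dimensional space of `N` qubits. -/
abbrev Op (N : ℕ) : Type := Matrix (Conf N) (Conf N) ℂ

/-- The (at most `d`) consecutive qubits `a, a + 1, …, a + d - 1`. -/
def window (N d a : ℕ) : Finset (Fin N) :=
  Finset.univ.filter fun q => a ≤ (q : ℕ) ∧ (q : ℕ) < a + d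

/-- `A` acts on the qubits of `W` only: `A = B_W ⊗ 1` for an operator `B` on the qubits in `W`. -/
def SupportedOn {N : ℕ} (W : Finset (Fin N)) (A : Op N) : Prop :=
  ∃ B : Matrix (W → Fin 2) (W → Fin 2) ℂ, ∀ x y : Conf N,
    A x y = if ∀ q, q ∉ W → x q = y q then B (fun q => x q) (fun q => y q) else 0

/-- A `d`-local observable: Hermitian, acting on at most `d` consecutive qubits. -/
def IsLocalObservable {N : ℕ} (d : ℕ) (A : Op N) : Prop :=
  A.IsHermitian ∧ ∃ a, SupportedOn (window N d a) A

/-! ### Approximate quantum error-correcting codes -/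

/-- The Kraus operators `K l` define a quantum channel `X ↦ ∑ l, K l X (K l)ᴴ`
(such a map is completely positive; this is the trace-preservation condition). -/
def IsChannel {n : Type*} [Fintype n] [DecidableEq n] {m : ℕ}
    (K : Fin m → Matrix n n ℂ) : Prop :=
  ∑ l, (K l)ᴴ * K l = 1

/-- The action of `Λ ⊗ id` on an operator of system and reference, `Λ` having Kraus operators
`K`. -/
def applyChannel {n r : Type*} [Fintype n] [Fintype r] [DecidableEq r] {m : ℕ}
    (K : Fin m → Matrix n n ℂ) (X : Matrix (n × r) (n × r) ℂ) : Matrix (n × r) (n × r) ℂ :=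
  ∑ l, (K l ⊗ₖ (1 : Matrix r r ℂ)) * X * (K l ⊗ₖ (1 : Matrix r r ℂ))ᴴ

/-- `⟨ψ| (𝒟 ∘ Λ ⊗ id)(|ψ⟩⟨ψ|) |ψ⟩`, where `D`, `K` are Kraus operators of `𝒟`, `Λ`. -/
def recoveryFidelity {n r : Type*} [Fintype n] [Fintype r] [DecidableEq r] {m m' : ℕ}
    (D : Fin m' → Matrix n n ℂ) (K : Fin m → Matrix n n ℂ) (ψ : n × r → ℂ) : ℝ :=
  (star ψ ⬝ᵥ (applyChannel D (applyChannel K (vecMulVec ψ (star ψ))) *ᵥ ψ)).re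

/-- `C` is an `[[N, k, d, ε]]` approximate quantum error-correcting code: `dim C = 2 ^ k`, and for
every channel on at most `d` consecutive qubits and every unit vector `ψ` in the tensor product of
`C` with a reference space of dimension `2 ^ k`, some decoding channel recovers `ψ` with
fidelity at least `1 - ε`. -/
def IsAQECC {N : ℕ} (k d : ℕ) (ε : ℝ) (C : Submodule ℂ (Conf N → ℂ)) : Prop :=
  Module.finrank ℂ C = 2 ^ k ∧
  ∀ (a m : ℕ) (K : Fin m → Op N), IsChannel K → (∀ l, SupportedOn (window N d a) (K l)) →
    ∀ ψ : Conf N × Fin (2 ^ k) → ℂ, (∀ r, (fun x => ψ (x, r)) ∈ C) → star ψ ⬝ᵥ ψ = 1 →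
      ∃ (m' : ℕ) (D : Fin m' → Op N), IsChannel D ∧ 1 - ε ≤ recoveryFidelity D K ψ

/-- The error of a code: the smallest `ε ≥ 0` for which it is an `[[N, k, d, ε]]` code. -/
def codeError {N : ℕ} (k d : ℕ) (C : Submodule ℂ (Conf N → ℂ)) : ℝ :=
  sInf {ε : ℝ | 0 ≤ ε ∧ IsAQECC k d ε C}

/-! ### Thermal correlators -/

/-- The power `ρ ^ s` of the thermal state `ρ = exp (-β H) / Z`, `Z = Tr exp (-β H)`. -/
def thermalPow {N : ℕ} (H : Op N) (β s : ℝ) : Op N :=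
  (((NormedSpace.exp ((-β : ℂ) • H)).trace.re ^ (-s) : ℝ) : ℂ) •
    NormedSpace.exp ((-(s * β) : ℂ) • H)

/-- Heisenberg evolution `A(t) = exp (i H t) A exp (-i H t)`. -/
def heisenberg {N : ℕ} (H A : Op N) (t : ℝ) : Op N :=
  NormedSpace.exp ((Complex.I * t) • H) * A * NormedSpace.exp ((-(Complex.I * t)) • H)

/-- The regulated two-point function `Tr[ρ^{1/2} A(t) ρ^{1/2} A]`. -/
def twoPoint {N : ℕ} (H A : Op N) (β t : ℝ) : ℂ :=
  (thermalPow H β (1 / 2) * heisenberg H A t * thermalPow H β (1 / 2) * A).trace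

/-- The regulated out-of-time-order correlator
`Tr[ρ^{1/4} A(t) ρ^{1/4} A ρ^{1/4} A(t) ρ^{1/4} A]`. -/
def otoc {N : ℕ} (H A : Op N) (β t : ℝ) : ℂ :=
  (thermalPow H β (1 / 4) * heisenberg H A t * thermalPow H β (1 / 4) * A *
    thermalPow H β (1 / 4) * heisenberg H A t * thermalPow H β (1 / 4) * A).trace

/-- `lam` is the Lyapunov exponent of a sequence of systems with two-point functions `F₂ n` and
out-of-time-order correlators `F n`. There are dissipation times `td`, bounded below, and
scrambling times `ts ≫ td`, such that at all times `td ≪ t ≪ ts` the two-point function has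
decayed, and `F n (t) ∝ 1 - exp (lam (t - ts))`, the exponential being correct up to a relative
error that vanishes in the limit. -/
def IsLyapunovExponent (F₂ F : ℕ → ℝ → ℂ) (lam : ℝ) : Prop :=
  ∃ td ts c : ℕ → ℝ,
    (∃ τ > 0, ∀ n, τ ≤ td n) ∧ (∀ n, 0 < ts n) ∧ (∀ n, c n ≠ 0) ∧ td =o[atTop] ts ∧
    ∀ t : ℕ → ℝ, (∀ n, 0 < t n) → td =o[atTop] t → t =o[atTop] ts →
      Tendsto (fun n => F₂ n (t n) / F₂ n 0) atTop (𝓝 0) ∧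
      Tendsto (fun n => (1 - F n (t n) / (c n : ℂ)) / (Real.exp (lam * (t n - ts n)) : ℂ))
        atTop (𝓝 1)

/-! ### Ensembles of Hamiltonians and the eigenstate thermalization hypothesis -/

/-- A random Hamiltonian on `N` qubits with given spectrum: energies `E i`, and a random
orthonormal basis of eigenvectors `|E i⟩`, the columns of the random unitary matrix `V`. -/
structure Ensemble (N : ℕ) (Ω : Type*) [MeasurableSpace Ω] where
  E : Conf N → ℝ
  V : Ω → Op N
  unitary : ∀ o, V o ∈ Matrix.unitaryGroup (Conf N) ℂ
  measurable : ∀ x i, Measurable fun o => V o x i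

namespace Ensemble

variable {N : ℕ} {Ω : Type*} [MeasurableSpace Ω] (Q : Ensemble N Ω)

/-- The Hamiltonian `∑ i, E i |E i⟩⟨E i|`. -/
def hamiltonian (o : Ω) : Op N :=
  Q.V o * Matrix.diagonal (fun i => (Q.E i : ℂ)) * (Q.V o)ᴴ

/-- The matrix element `⟨E i| A |E j⟩`. -/
def matrixElement (A : Op N) (i j : Conf N) (o : Ω) : ℂ :=
  ((Q.V o)ᴴ * A * Q.V o) i j

/-- The labels of the energies in the microcanonical shell `[E₀ - Δ, E₀ + Δ]`. -/
def shell (E₀ Δ : ℝ) : Finset (Conf N) :=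
  Finset.univ.filter fun i => |Q.E i - E₀| ≤ Δ

/-- The microcanonical entropy: the logarithm of the number of eigenstates in the shell. -/
def entropy (E₀ Δ : ℝ) : ℝ :=
  Real.log ((Q.shell E₀ Δ).card : ℝ)

/-- The eigenstate thermalization ansatz in the shell, for all normalized `d`-local observables `A`:
`⟨E i| A |E j⟩ = Abar(E₀) δ_ij + exp (-S / 2) f(E₀, ω) R_ij` with `ω = E i - E j`,
smooth functions `Abar`, `f` depending on `A`, random variables `R_ij` of zero mean and unit
variance, and spectral function `f(E₀, ω) ≲ exp (-β |ω| / 4)` with implied constant `c`. -/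
def SatisfiesETH (P : Measure Ω) (d : ℕ) (E₀ Δ β c : ℝ) : Prop :=
  ∀ A : Op N, IsLocalObservable d A → ‖Matrix.toEuclideanCLM (𝕜 := ℂ) A‖ ≤ 1 →
    ∃ (Abar : ℝ → ℝ) (f : ℝ × ℝ → ℝ) (R : Conf N → Conf N → Ω → ℂ),
      ContDiff ℝ (⊤ : ℕ∞) Abar ∧ ContDiff ℝ (⊤ : ℕ∞) f ∧
      (∀ w : ℝ, |f (E₀, w)| ≤ c * Real.exp (-(β / 4) * |w|)) ∧
      ∀ i ∈ Q.shell E₀ Δ, ∀ j ∈ Q.shell E₀ Δ,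
        MemLp (R i j) 2 P ∧ ∫ o, R i j o ∂P = 0 ∧ ∫ o, ‖R i j o‖ ^ 2 ∂P = 1 ∧
        ∀ᵐ o ∂P, Q.matrixElement A i j o =
          (if i = j then (Abar E₀ : ℂ) else 0) +
            ((Real.exp (-(Q.entropy E₀ Δ) / 2) * f (E₀, Q.E i - Q.E j) : ℝ) : ℂ) * R i j o

/-- The code spanned by the eigenstates with labels `s r`. -/
def codeSpace {K : ℕ} (s : Fin K ↪ Conf N) (o : Ω) : Submodule ℂ (Conf N → ℂ) :=
  Submodule.span ℂ (Set.range fun r x => Q.V o x (s r))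

end Ensemble

end

end ChaosCode

/-!
On a window of `d` qubits, ETH makes every matrix unit, compressed to the eigenstates of the shell,
a multiple of the identity up to fluctuations of order `σ ~ exp (-S / 2)`: the code satisfies the
Knill–Laflamme conditions in mean square. When they hold up to `Y` in squared Frobenius norm, the
window is nearly decoupled from the reference, and Uhlmann's theorem, quantified by a
Powers–Størmer inequality, yields a decoder with error `√(2 ^ (d + k) * Y)`. By Markov's inequality,
`Y ≤ (2 ^ (d + k) * (N + 1) * σ) ^ 2` for all windows, outside an event of probability
`1 / (N + 1)`, whence `log ε ≤ 3 / 2 * (d + k) * log 2 - S / 2 + o(S)`. A weighted combination with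
`log ε ≤ 0` gives `2 * log (2 ^ (d + 2 * k) / ε) - S / 2 ≥ S / 6 - o(S)`. This is extensive, whereas
`|ω| ≤ 2 * |Δ|` is subextensive, so the bound holds with any positive constant for `λ`.
-/

namespace ChaosCode

/-! ### Partial isometries and the Frobenius norm -/

section LinearAlgebra

open scoped MatrixOrder ComplexOrder

variable {m n : Type*} [Fintype m] [Fintype n]

lemma conjTranspose_mul_self_le_one_of_partialIsometry [DecidableEq n] {U : Matrix m n ℂ}
    (hU : U * Uᴴ * U = U) : Uᴴ * U ≤ 1 := by
  have idem : (1 - Uᴴ * U)ᴴ * (1 - Uᴴ * U) = 1 - Uᴴ * U := by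
    have hUU : Uᴴ * U * (Uᴴ * U) = Uᴴ * U := by
      rw [Matrix.mul_assoc, ← Matrix.mul_assoc U, hU]
    simp [Matrix.sub_mul, Matrix.mul_sub, hUU]
  rw [Matrix.le_iff, ← idem]
  exact posSemidef_conjTranspose_mul_self _

lemma self_mul_conjTranspose_le_one_of_partialIsometry [DecidableEq m] {U : Matrix m n ℂ}
    (hU : U * Uᴴ * U = U) : U * Uᴴ ≤ 1 := by
  simpa using conjTranspose_mul_self_le_one_of_partialIsometry (U := Uᴴ)
    (by simpa [Matrix.mul_assoc] using congrArg conjTranspose hU)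

lemma conjTranspose_mul_mul_mono {n : Type*} [Finite n] {A B : Matrix m m ℂ} (h : A ≤ B)
    (U : Matrix m n ℂ) : Uᴴ * A * U ≤ Uᴴ * B * U := by
  cases nonempty_fintype n
  rw [Matrix.le_iff, ← Matrix.sub_mul, ← Matrix.mul_sub]
  exact (Matrix.le_iff.mp h).conjTranspose_mul_mul_same U

lemma exists_polar (A : Matrix m n ℂ) :
    ∃ (U : Matrix m n ℂ) (P : Matrix m m ℂ), U * Uᴴ * U = U ∧ P.PosSemidef ∧
      P * P = A * Aᴴ ∧ A * Uᴴ = P := by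
  classical
  have hA : (A * Aᴴ).PosSemidef := posSemidef_self_mul_conjTranspose A
  have hcont (f : ℝ → ℝ) : ContinuousOn f (spectrum ℝ (A * Aᴴ)) :=
    (finite_real_spectrum (A := A * Aᴴ)).continuousOn f
  have hself : IsSelfAdjoint (A * Aᴴ) := hA.1
  set P : Matrix m m ℂ := cfc Real.sqrt (A * Aᴴ) with hP
  set G : Matrix m m ℂ := cfc (fun x => (√x)⁻¹) (A * Aᴴ) with hG
  have hGH : Gᴴ = G := cfc_predicate (fun x => (√x)⁻¹) (A * Aᴴ)
  have hAG : A * Aᴴ * G = P := by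
    nth_rewrite 1 [← cfc_id' ℝ (A * Aᴴ)]
    rw [hG, ← cfc_mul _ _ _ (hcont _) (hcont _)]
    simp_rw [← div_eq_mul_inv, Real.div_sqrt, hP]
  have hGPG : G * P * G = G := by
    rw [hG, hP, ← cfc_mul _ _ _ (hcont _) (hcont _), ← cfc_mul _ _ _ (hcont _) (hcont _)]
    congr! 2 with x
    by_cases hx : √x = 0
    · simp [hx]
    · field_simp
  refine ⟨G * A, P, ?_, ?_, ?_, ?_⟩
  · calc G * A * (G * A)ᴴ * (G * A) = G * (A * Aᴴ * G) * G * A := by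
          simp only [conjTranspose_mul, hGH, Matrix.mul_assoc]
      _ = G * A := by rw [hAG, hGPG]
  · exact nonneg_iff_posSemidef.mp (cfc_nonneg fun x _ => Real.sqrt_nonneg x)
  · rw [hP, ← cfc_mul _ _ _ (hcont _) (hcont _)]
    nth_rewrite 2 [← cfc_id' ℝ (A * Aᴴ)]
    exact cfc_congr fun x hx => Real.mul_self_sqrt (spectrum_nonneg_of_nonneg hA.nonneg hx)
  · rw [conjTranspose_mul, hGH, ← Matrix.mul_assoc, hAG]

end LinearAlgebra

section Frobenius

open scoped MatrixOrder ComplexOrder Matrix.Norms.Frobenius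

variable {m n p q : Type*} [Fintype m] [Fintype n] [Fintype p]

lemma frobenius_norm_sq (A : Matrix m n ℂ) : ‖A‖ ^ 2 = ∑ i, ∑ j, ‖A i j‖ ^ 2 := by
  rw [frobenius_norm_def, ← Real.sqrt_eq_rpow, Real.sq_sqrt (by positivity)]
  simp only [Real.rpow_two]

lemma frobenius_norm_sq_eq_trace (A : Matrix m n ℂ) :
    ((‖A‖ ^ 2 : ℝ) : ℂ) = (A * Aᴴ).trace := by
  simp [frobenius_norm_sq, trace, mul_apply, Complex.mul_conj']

lemma frobenius_norm_sub_sq (A B : Matrix m n ℂ) :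
    ‖A - B‖ ^ 2 = ‖A‖ ^ 2 + ‖B‖ ^ 2 - 2 * (A * Bᴴ).trace.re := by
  have hconj : (B * Aᴴ).trace = star (A * Bᴴ).trace := by
    rw [← trace_conjTranspose, conjTranspose_mul, conjTranspose_conjTranspose]
  have := congrArg Complex.re (frobenius_norm_sq_eq_trace (A - B))
  rw [conjTranspose_sub, Matrix.sub_mul, Matrix.mul_sub, Matrix.mul_sub, trace_sub, trace_sub,
    trace_sub, ← frobenius_norm_sq_eq_trace, ← frobenius_norm_sq_eq_trace, hconj] at this
  simp only [Complex.sub_re, Complex.ofReal_re, RCLike.star_def, Complex.conj_re] at this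
  linarith

lemma frobenius_norm_kronecker [Fintype q] (A : Matrix m n ℂ) (B : Matrix p q ℂ) :
    ‖A ⊗ₖ B‖ = ‖A‖ * ‖B‖ := by
  rw [← sq_eq_sq₀ (norm_nonneg _) (by positivity), ← Complex.ofReal_inj, mul_pow,
    Complex.ofReal_mul]
  simp only [frobenius_norm_sq_eq_trace, conjTranspose_kronecker, ← mul_kronecker_mul,
    trace_kronecker]

lemma trace_conjTranspose_mul (A B : Matrix m n ℂ) :
    (Aᴴ * B).trace = ∑ i, ∑ j, star (A i j) * B i j := by
  simp only [trace, diag_apply, Matrix.mul_apply, conjTranspose_apply]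
  exact Finset.sum_comm

lemma sq_norm_trace_conjTranspose_mul_le (A B : Matrix m n ℂ) :
    ‖(Aᴴ * B).trace‖ ^ 2 ≤ ‖A‖ ^ 2 * ‖B‖ ^ 2 := by
  rw [trace_conjTranspose_mul, ← Fintype.sum_prod_type', frobenius_norm_sq, frobenius_norm_sq,
    ← Fintype.sum_prod_type', ← Fintype.sum_prod_type']
  calc _ ≤ (∑ ij : m × n, ‖A ij.1 ij.2‖ * ‖B ij.1 ij.2‖) ^ 2 := by
        gcongr
        exact norm_sum_le_of_le _ fun ij _ => by rw [norm_mul, norm_star]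
    _ ≤ _ := Finset.sum_mul_sq_le_sq_mul_sq _ _ _

lemma frobenius_norm_unitary_conj [DecidableEq m] {W : Matrix m m ℂ}
    (hW : W ∈ unitaryGroup m ℂ) (A : Matrix m m ℂ) : ‖Wᴴ * A * W‖ = ‖A‖ := by
  have hW' : W * Wᴴ = 1 := mem_unitaryGroup_iff.mp hW
  rw [← sq_eq_sq₀ (norm_nonneg _) (norm_nonneg _), ← Complex.ofReal_inj,
    frobenius_norm_sq_eq_trace, frobenius_norm_sq_eq_trace]
  calc (Wᴴ * A * W * (Wᴴ * A * W)ᴴ).trace = (Wᴴ * A * (W * Wᴴ) * Aᴴ * W).trace := by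
        simp [Matrix.mul_assoc]
    _ = (A * Aᴴ).trace := by
        rw [hW', Matrix.trace_mul_comm]; simp [← Matrix.mul_assoc, hW']

lemma frobenius_norm_eq_of_mul_self_eq {P : Matrix m m ℂ} (hP : P.IsHermitian) {A : Matrix m n ℂ}
    (h : P * P = A * Aᴴ) : ‖P‖ = ‖A‖ := by
  rw [← sq_eq_sq₀ (norm_nonneg _) (norm_nonneg _), ← Complex.ofReal_inj,
    frobenius_norm_sq_eq_trace, frobenius_norm_sq_eq_trace, hP.eq, h]

lemma sum_norm_diag_le (A : Matrix m m ℂ) : ∑ i, ‖A i i‖ ≤ √(Fintype.card m) * ‖A‖ := by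
  rw [← abs_of_nonneg (Finset.sum_nonneg fun i _ => norm_nonneg (A i i)),
    ← Real.sqrt_sq (norm_nonneg A), ← Real.sqrt_mul (by positivity), frobenius_norm_sq]
  refine Real.abs_le_sqrt ?_
  calc (∑ i, ‖A i i‖) ^ 2 ≤ Fintype.card m * ∑ i, ‖A i i‖ ^ 2 := sq_sum_le_card_mul_sum_sq
    _ ≤ _ := by
        gcongr with i
        exact Finset.single_le_sum (f := fun j => ‖A i j‖ ^ 2) (fun j _ => by positivity)
          (Finset.mem_univ i)

lemma frobenius_norm_sub_sq_le_of_sub_eq_diagonal [DecidableEq m] {P Q : Matrix m m ℂ}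
    (hP : P.PosSemidef) (hQ : Q.PosSemidef) {μ : m → ℝ} (h : P - Q = diagonal fun i => (μ i : ℂ)) :
    ‖P - Q‖ ^ 2 ≤ √(Fintype.card m) * ‖P * P - Q * Q‖ := by
  have hdiag (i : m) : (P * P - Q * Q) i i = μ i * (P i i + Q i i) := by
    have : P * P - Q * Q = (P - Q) * P + Q * (P - Q) := by noncomm_ring
    rw [this, h, Matrix.add_apply, diagonal_mul, mul_diagonal]
    ring
  have hμ (i : m) : ‖μ i‖ ≤ ‖P i i + Q i i‖ := by
    obtain ⟨x, hx, hx'⟩ := RCLike.nonneg_iff_exists_ofReal.mp (hP.diag_nonneg (i := i))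
    obtain ⟨y, hy, hy'⟩ := RCLike.nonneg_iff_exists_ofReal.mp (hQ.diag_nonneg (i := i))
    have hμ : μ i = x - y := by
      have := congrFun (congrFun h i) i
      rw [Matrix.sub_apply, diagonal_apply_eq, ← hx', ← hy'] at this
      exact Complex.ofReal_injective (by simpa using this.symm)
    rw [← hx', ← hy', ← RCLike.ofReal_add, RCLike.norm_ofReal, hμ, Real.norm_eq_abs, abs_le,
      abs_of_nonneg (add_nonneg hx hy)]
    constructor <;> linarith
  calc ‖P - Q‖ ^ 2 = ∑ i, ‖μ i‖ ^ 2 := by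
        rw [h, frobenius_norm_sq]
        refine Finset.sum_congr rfl fun i _ => ?_
        rw [Finset.sum_eq_single i (fun j _ hj => by simp [diagonal_apply_ne' _ hj]) (by simp)]
        simp
    _ ≤ ∑ i, ‖(P * P - Q * Q) i i‖ := by
        gcongr with i
        rw [hdiag, norm_mul, Complex.norm_real, sq]
        gcongr
        exact hμ i
    _ ≤ _ := sum_norm_diag_le _

/-- A Powers–Størmer inequality, with the trace norm bounded by the Hilbert–Schmidt norm. -/
lemma frobenius_norm_sub_sq_le_of_posSemidef [DecidableEq m] {P Q : Matrix m m ℂ}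
    (hP : P.PosSemidef) (hQ : Q.PosSemidef) :
    ‖P - Q‖ ^ 2 ≤ √(Fintype.card m) * ‖P * P - Q * Q‖ := by
  have hPQ : (P - Q).IsHermitian := hP.1.sub hQ.1
  set W : Matrix m m ℂ := (hPQ.eigenvectorUnitary : Matrix m m ℂ)
  have hW : W ∈ unitaryGroup m ℂ := hPQ.eigenvectorUnitary.2
  have hWW : W * Wᴴ = 1 := mem_unitaryGroup_iff.mp hW
  have conj_mul (A B : Matrix m m ℂ) : Wᴴ * A * W * (Wᴴ * B * W) = Wᴴ * (A * B) * W := by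
    simp only [Matrix.mul_assoc]
    rw [← Matrix.mul_assoc W, hWW, Matrix.one_mul]
  have conj_sub (A B : Matrix m m ℂ) : Wᴴ * A * W - Wᴴ * B * W = Wᴴ * (A - B) * W := by
    rw [Matrix.mul_sub, Matrix.sub_mul]
  have hdiag : Wᴴ * P * W - Wᴴ * Q * W = diagonal fun i => (hPQ.eigenvalues i : ℂ) := by
    rw [conj_sub]
    exact (Unitary.conjStarAlgAut_star_apply _ _).symm.trans
      hPQ.conjStarAlgAut_star_eigenvectorUnitary
  have := frobenius_norm_sub_sq_le_of_sub_eq_diagonal (hP.conjTranspose_mul_mul_same W)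
    (hQ.conjTranspose_mul_mul_same W) hdiag
  simpa only [conj_mul, conj_sub, frobenius_norm_unitary_conj hW] using this

/-- A quantitative form of Uhlmann's theorem: `C` is the product of the partial isometries in the
polar decompositions of `Ψ` and `Θ`. -/
lemma exists_contraction_overlap [DecidableEq m] [DecidableEq n] (Ψ : Matrix m n ℂ)
    (Θ : Matrix m p ℂ) (hΨ : ‖Ψ‖ = 1) (hΘ : ‖Θ‖ = 1) :
    ∃ C : Matrix n p ℂ, C * Cᴴ ≤ 1 ∧
      1 - √(Fintype.card m) * ‖Ψ * Ψᴴ - Θ * Θᴴ‖ ≤ ‖(Ψ * C * Θᴴ).trace‖ ^ 2 := by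
  obtain ⟨U, P, hU, hP, hPP, hPU⟩ := exists_polar Ψ
  obtain ⟨T, Q, hT, hQ, hQQ, hQT⟩ := exists_polar Θ
  refine ⟨Uᴴ * T, ?_, ?_⟩
  · calc Uᴴ * T * (Uᴴ * T)ᴴ = Uᴴ * (T * Tᴴ) * U := by simp [Matrix.mul_assoc]
      _ ≤ Uᴴ * 1 * U :=
        conjTranspose_mul_mul_mono (self_mul_conjTranspose_le_one_of_partialIsometry hT) U
      _ ≤ 1 := by
        simpa using conjTranspose_mul_self_le_one_of_partialIsometry hU
  · have htrace : (Ψ * (Uᴴ * T) * Θᴴ).trace = (P * Q).trace := by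
      have hTΘ : T * Θᴴ = Q := by simpa [hQ.1.eq] using congrArg conjTranspose hQT
      rw [← Matrix.mul_assoc, Matrix.mul_assoc, hTΘ, hPU]
    have hPnorm : ‖P‖ = ‖Ψ‖ := frobenius_norm_eq_of_mul_self_eq hP.1 hPP
    have hQnorm : ‖Q‖ = ‖Θ‖ := frobenius_norm_eq_of_mul_self_eq hQ.1 hQQ
    have hdist : 2 - 2 * (P * Q).trace.re ≤ √(Fintype.card m) * ‖Ψ * Ψᴴ - Θ * Θᴴ‖ := by
      calc 2 - 2 * (P * Q).trace.re = ‖P - Q‖ ^ 2 := by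
            rw [frobenius_norm_sub_sq, hPnorm, hQnorm, hΨ, hΘ, hQ.1.eq]; ring
        _ ≤ _ := by rw [← hPP, ← hQQ]; exact frobenius_norm_sub_sq_le_of_posSemidef hP hQ
    have hre : (P * Q).trace.re ^ 2 ≤ ‖(P * Q).trace‖ ^ 2 :=
      sq_le_sq.mpr ((Complex.abs_re_le_norm _).trans (le_abs_self _))
    rw [htrace]
    linarith [sq_nonneg ((P * Q).trace.re - 1)]

end Frobenius

/-! ### Recovery fidelity and decoders -/

section Recovery

open scoped MatrixOrder ComplexOrder Matrix.Norms.Frobenius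

variable {S X R T : Type*} [Fintype S] [Fintype X] [Fintype R] [Fintype T]

lemma IsChannel.sum_frobenius_norm_sq_mul [DecidableEq X] {m : ℕ} {B : Fin m → Matrix X X ℂ}
    (hB : IsChannel B) (G : Matrix X T ℂ) : ∑ l, ‖B l * G‖ ^ 2 = ‖G‖ ^ 2 := by
  rw [← Complex.ofReal_inj, Complex.ofReal_sum]
  calc ∑ l, ((‖B l * G‖ ^ 2 : ℝ) : ℂ) = ∑ l, ((B l)ᴴ * B l * (G * Gᴴ)).trace := by
        refine Finset.sum_congr rfl fun l _ => ?_
        rw [frobenius_norm_sq_eq_trace, conjTranspose_mul, Matrix.mul_assoc (B l)ᴴ,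
          Matrix.trace_mul_comm (B l)ᴴ]
        simp only [Matrix.mul_assoc]
    _ = ((‖G‖ ^ 2 : ℝ) : ℂ) := by
        rw [← trace_sum, ← Matrix.sum_mul, show ∑ l, (B l)ᴴ * B l = 1 from hB, Matrix.one_mul,
          frobenius_norm_sq_eq_trace]

lemma star_vec_dotProduct_kronecker_one_mulVec [DecidableEq R] (M : Matrix S S ℂ)
    (Φ : Matrix S R ℂ) :
    star (vec Φᵀ) ⬝ᵥ ((M ⊗ₖ (1 : Matrix R R ℂ)) *ᵥ vec Φᵀ) = (Φᴴ * M * Φ).trace := by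
  rw [kronecker_mulVec_vec, star_vec_dotProduct_vec, Matrix.one_mul, ← transpose_mul,
    ← trace_transpose, transpose_mul, transpose_transpose, Matrix.mul_assoc Φᴴ]
  exact Matrix.trace_mul_comm (M * Φ) Φᴴ

lemma star_dotProduct_conj_vecMulVec_mulVec (A : Matrix S S ℂ) (ψ : S → ℂ) :
    star ψ ⬝ᵥ ((A * vecMulVec ψ (star ψ) * Aᴴ) *ᵥ ψ) = ((‖star ψ ⬝ᵥ (A *ᵥ ψ)‖ ^ 2 : ℝ) : ℂ) := by
  have hproj : A * vecMulVec ψ (star ψ) * Aᴴ = vecMulVec (A *ᵥ ψ) (star (A *ᵥ ψ)) := by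
    rw [mul_vecMulVec, vecMulVec_mul, star_mulVec]
  have hconj : star (A *ᵥ ψ) ⬝ᵥ ψ = star (star ψ ⬝ᵥ (A *ᵥ ψ)) := by
    rw [star_dotProduct, dotProduct_comm]
  rw [hproj, vecMulVec_mulVec, hconj, dotProduct_smul, op_smul_eq_mul, RCLike.star_def,
    Complex.mul_conj']
  norm_cast

lemma recoveryFidelity_vec [DecidableEq R] {m m' : ℕ} (D : Fin m' → Matrix S S ℂ)
    (K : Fin m → Matrix S S ℂ) (Φ : Matrix S R ℂ) :
    recoveryFidelity D K (vec Φᵀ) = ∑ l', ∑ l, ‖(Φᴴ * (D l' * K l) * Φ).trace‖ ^ 2 := by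
  set ψ := vec Φᵀ
  have hterm (A B : Matrix S S ℂ) :
      star ψ ⬝ᵥ ((A ⊗ₖ (1 : Matrix R R ℂ) * (B ⊗ₖ (1 : Matrix R R ℂ) * vecMulVec ψ (star ψ) *
        (B ⊗ₖ (1 : Matrix R R ℂ))ᴴ) * (A ⊗ₖ (1 : Matrix R R ℂ))ᴴ) *ᵥ ψ) =
      ((‖(Φᴴ * (A * B) * Φ).trace‖ ^ 2 : ℝ) : ℂ) := by
    rw [← star_vec_dotProduct_kronecker_one_mulVec, ← star_dotProduct_conj_vecMulVec_mulVec,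
      show (A * B) ⊗ₖ (1 : Matrix R R ℂ) = A ⊗ₖ 1 * B ⊗ₖ 1 by
        rw [← mul_kronecker_mul, Matrix.one_mul], conjTranspose_mul]
    simp only [Matrix.mul_assoc, ψ]
  simp only [recoveryFidelity, applyChannel, Matrix.mul_sum, Matrix.sum_mul, sum_mulVec,
    dotProduct_sum, hterm, Complex.re_sum, Complex.ofReal_re]

lemma recoveryFidelity_nonneg [DecidableEq R] {m m' : ℕ} (D : Fin m' → Matrix S S ℂ)
    (K : Fin m → Matrix S S ℂ) (ψ : S × R → ℂ) : 0 ≤ recoveryFidelity D K ψ := by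
  obtain ⟨Φ, rfl⟩ : ∃ Φ : Matrix S R ℂ, ψ = vec Φᵀ := ⟨of fun s r => ψ (s, r), rfl⟩
  rw [recoveryFidelity_vec]
  positivity

lemma sum_le_recoveryFidelity_vec [DecidableEq R] {m m' : ℕ} (D : Fin m' → Matrix S S ℂ)
    (f : T ↪ Fin m') (K : Fin m → Matrix S S ℂ) (Φ : Matrix S R ℂ) :
    ∑ i, ∑ l, ‖(Φᴴ * (D (f i) * K l) * Φ).trace‖ ^ 2 ≤ recoveryFidelity D K (vec Φᵀ) := by
  rw [recoveryFidelity_vec,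
    ← Finset.sum_map Finset.univ f fun j => ∑ l, ‖(Φᴴ * (D j * K l) * Φ).trace‖ ^ 2]
  exact Finset.sum_le_univ_sum_of_nonneg fun j => by positivity

lemma exists_isChannel_extending [DecidableEq S] (D : T → Matrix S S ℂ)
    (hD : ∑ i, (D i)ᴴ * D i ≤ 1) :
    ∃ (m : ℕ) (D' : Fin m → Matrix S S ℂ) (f : T ↪ Fin m), IsChannel D' ∧ ∀ i, D' (f i) = D i := by
  obtain ⟨Y, hY⟩ := CStarAlgebra.nonneg_iff_eq_star_mul_self.mp (sub_nonneg.mpr hD)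
  let e := Fintype.equivFin (Option T)
  let G : Option T → Matrix S S ℂ := fun o => o.elim Y D
  refine ⟨_, fun i => G (e.symm i), Function.Embedding.some.trans e.toEmbedding, ?_, ?_⟩
  · rw [IsChannel, Equiv.sum_comp e.symm (fun o => (G o)ᴴ * G o), Fintype.sum_option]
    simp only [G, Option.elim_none, Option.elim_some, ← star_eq_conjTranspose, ← hY]
    exact sub_add_cancel _ _
  · simp [G]

end Recovery

section Decoder

open scoped MatrixOrder ComplexOrder Matrix.Norms.Frobenius

variable {S X Z R T : Type*}

/-- The operator `⟨x| ⊗ 1`, from the system `S`, split by `e` into the subsystems `X` and `Z`,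
to the subsystem `Z`. -/
def bra [DecidableEq S] (e : S ≃ X × Z) (x : X) : Matrix Z S ℂ :=
  (1 : Matrix S S ℂ).submatrix (fun z => e.symm (x, z)) id

lemma bra_apply [DecidableEq S] [DecidableEq X] [DecidableEq Z] (e : S ≃ X × Z)
    (x : X) (z : Z) (s : S) :
    bra e x z s = if e s = (x, z) then 1 else 0 := by
  simp [bra, one_apply, e.symm_apply_eq, eq_comm (a := e s)]

lemma bra_mul [Fintype S] [DecidableEq S] (e : S ≃ X × Z) (x : X) (A : Matrix S R ℂ) :
    bra e x * A = A.submatrix (fun z => e.symm (x, z)) id :=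
  one_submatrix_mul _ (Equiv.refl S) A

lemma sum_conjTranspose_bra_mul_bra [Fintype X] [Fintype Z] [DecidableEq S] (e : S ≃ X × Z) :
    ∑ x, (bra e x)ᴴ * bra e x = 1 := by
  ext s s'
  simp only [Matrix.sum_apply, Matrix.mul_apply, conjTranspose_apply, bra, submatrix_apply]
  rw [← Fintype.sum_prod_type', Fintype.sum_eq_single (e s) fun i hi => ?_]
  · simp [one_apply, apply_ite]
  · simp [e.symm_apply_eq.not.mpr hi]

/-- The amplitude matrix of the state of `X` and the reference `R`, purified by `Z`, when the
state of `S` and `R` has the amplitude matrix `Φ`. -/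
def reshape (e : S ≃ X × Z) (Φ : Matrix S R ℂ) : Matrix (X × R) Z ℂ :=
  of fun i z => Φ (e.symm (i.1, z)) i.2

variable [Fintype S] [Fintype X] [Fintype Z]

lemma frobenius_norm_reshape [Fintype R] (e : S ≃ X × Z) (Φ : Matrix S R ℂ) :
    ‖reshape e Φ‖ = ‖Φ‖ := by
  rw [← sq_eq_sq₀ (norm_nonneg _) (norm_nonneg _), frobenius_norm_sq, frobenius_norm_sq,
    ← Equiv.sum_comp e.symm, Fintype.sum_prod_type, Fintype.sum_prod_type]
  exact Finset.sum_congr rfl fun x _ => Finset.sum_comm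

variable [DecidableEq S]

/-- The Kraus operator with label `(x, t)` of the map that discards the subsystem `X`, maps the
subsystem `Z` to `T × S` by the transpose of `C`, and discards `T`. -/
def decoderKraus (e : S ≃ X × Z) (C : Matrix Z (T × S) ℂ) (i : X × T) :
    Matrix S S ℂ :=
  Cᵀ.submatrix (fun s => (i.2, s)) id * bra e i.1

variable [Fintype T]

lemma sum_conjTranspose_mul_decoderKraus_le_one [DecidableEq Z] (e : S ≃ X × Z)
    {C : Matrix Z (T × S) ℂ} (hC : C * Cᴴ ≤ 1) :
    ∑ i, (decoderKraus e C i)ᴴ * decoderKraus e C i ≤ 1 := by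
  have hsum : ∑ t : T, (Cᵀ.submatrix (fun s => (t, s)) id)ᴴ * Cᵀ.submatrix (fun s => (t, s)) id
      = (C * Cᴴ)ᵀ := by
    ext z z'
    simp [Matrix.sum_apply, mul_apply, Fintype.sum_prod_type, mul_comm]
  have hC' : (C * Cᴴ)ᵀ ≤ 1 := by
    simpa [Matrix.le_iff] using (Matrix.le_iff.mp hC).transpose
  calc ∑ i, (decoderKraus e C i)ᴴ * decoderKraus e C i
      = ∑ x, (bra e x)ᴴ * (C * Cᴴ)ᵀ * bra e x := by
        simp_rw [Fintype.sum_prod_type, ← hsum, Matrix.mul_sum, Matrix.sum_mul, decoderKraus,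
          conjTranspose_mul, Matrix.mul_assoc]
    _ ≤ ∑ x, (bra e x)ᴴ * 1 * bra e x :=
        Finset.sum_le_sum fun x _ => conjTranspose_mul_mul_mono hC' _
    _ = 1 := by simp_rw [Matrix.mul_one, sum_conjTranspose_bra_mul_bra]

lemma trace_reshape_mul_kronecker [Fintype R] (e : S ≃ X × Z)
    (Φ : Matrix S R ℂ) (Χ : Matrix X T ℂ) (C : Matrix Z (T × S) ℂ) :
    (reshape e Φ * C * (Χ ⊗ₖ Φᵀ)ᴴ).trace =
      (Χᴴ * of fun x t => (Φᴴ * decoderKraus e C (x, t) * Φ).trace).trace := by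
  have hentry (x : X) (t : T) : (Φᴴ * decoderKraus e C (x, t) * Φ).trace =
      ∑ r, ∑ s, star (Φ s r) * ∑ z, C z (t, s) * Φ (e.symm (x, z)) r := by
    simp [decoderKraus, Matrix.mul_assoc, bra_mul, trace, Matrix.mul_apply]
  simp only [trace_conjTranspose_mul, of_apply, hentry]
  simp only [trace, diag_apply, Matrix.mul_apply, conjTranspose_apply, kronecker_apply, reshape,
    of_apply, transpose_apply, Fintype.sum_prod_type, Finset.mul_sum, Finset.sum_mul, star_mul']
  refine Finset.sum_congr rfl fun x _ => ?_
  rw [Finset.sum_comm]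
  refine Finset.sum_congr rfl fun t _ => Finset.sum_congr rfl fun r _ =>
    Finset.sum_congr rfl fun s _ => Finset.sum_congr rfl fun z _ => ?_
  ring

variable [DecidableEq X] [DecidableEq Z]

/-- The operator `B ⊗ 1` on the system `S`, split by `e` into the subsystems `X` and `Z`. -/
def ampliation (e : S ≃ X × Z) : Matrix X X ℂ →⋆ₐ[ℂ] Matrix S S ℂ where
  toFun B := (B ⊗ₖ (1 : Matrix Z Z ℂ)).submatrix e e
  map_zero' := by simp
  map_one' := by simp
  map_add' A B := by rw [add_kronecker, submatrix_add]; rfl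
  map_mul' A B := by rw [submatrix_mul_equiv, ← mul_kronecker_mul, Matrix.mul_one]
  commutes' a := by
    simp only [Algebra.algebraMap_eq_smul_one, smul_kronecker, one_kronecker_one, submatrix_smul,
      Pi.smul_apply, submatrix_one_equiv]
  map_star' B := by
    simp only [star_eq_conjTranspose, conjTranspose_submatrix, conjTranspose_kronecker,
      conjTranspose_one]

lemma ampliation_apply (e : S ≃ X × Z) (B : Matrix X X ℂ) (s s' : S) :
    ampliation e B s s' = B (e s).1 (e s').1 * (1 : Matrix Z Z ℂ) (e s).2 (e s').2 :=
  rfl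

lemma conjTranspose_bra_mul_bra (e : S ≃ X × Z) (x y : X) :
    (bra e x)ᴴ * bra e y = ampliation e (single x y 1) := by
  ext s s'
  obtain ⟨⟨a, z⟩, rfl⟩ := e.symm.surjective s
  obtain ⟨⟨b, z'⟩, rfl⟩ := e.symm.surjective s'
  simp only [mul_apply, conjTranspose_apply, bra_apply, Equiv.apply_symm_apply, Prod.mk.injEq,
    ite_and, apply_ite star, star_one, star_zero, ite_mul, one_mul, zero_mul,
    Finset.sum_ite_irrel, Finset.sum_const_zero, Finset.sum_ite_eq, Finset.mem_univ, if_true,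
    ampliation_apply, single_apply, one_apply]
  grind

lemma conjTranspose_mul_ampliation_single_mul (e : S ≃ X × Z) (A : Matrix S R ℂ)
    (x y : X) :
    Aᴴ * ampliation e (single x y 1) * A = (bra e x * A)ᴴ * (bra e y * A) := by
  rw [← conjTranspose_bra_mul_bra, conjTranspose_mul]
  simp only [Matrix.mul_assoc]

lemma bra_mul_ampliation (e : S ≃ X × Z) (x : X) (B : Matrix X X ℂ) :
    bra e x * ampliation e B = ∑ y, B x y • bra e y := by
  ext z s
  obtain ⟨⟨y, z'⟩, rfl⟩ := e.symm.surjective s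
  rw [bra_mul, Matrix.sum_apply]
  simp [ampliation_apply, bra_apply, one_apply, ite_and, eq_comm]

variable [Fintype R]

lemma sum_norm_sq_decoderKraus (e : S ≃ X × Z) (Φ : Matrix S R ℂ) (C : Matrix Z (T × S) ℂ)
    {m : ℕ} {B : Fin m → Matrix X X ℂ} (hB : IsChannel B) :
    ∑ i, ∑ l, ‖(Φᴴ * (decoderKraus e C i * ampliation e (B l)) * Φ).trace‖ ^ 2 =
      ‖of fun x t => (Φᴴ * decoderKraus e C (x, t) * Φ).trace‖ ^ 2 := by
  set G : Matrix X T ℂ := of fun x t => (Φᴴ * decoderKraus e C (x, t) * Φ).trace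
  have hmul (l : Fin m) (x : X) (t : T) :
      (Φᴴ * (decoderKraus e C (x, t) * ampliation e (B l)) * Φ).trace = (B l * G) x t := by
    simp only [decoderKraus, Matrix.mul_assoc _ (bra e x), bra_mul_ampliation, Matrix.mul_sum,
      Matrix.sum_mul, Matrix.mul_smul, Matrix.smul_mul, trace_sum, trace_smul, G,
      smul_eq_mul, Matrix.mul_apply (M := B l), of_apply]
  rw [Finset.sum_comm, ← hB.sum_frobenius_norm_sq_mul]
  simp_rw [Fintype.sum_prod_type, hmul, frobenius_norm_sq]

/-- If the state of `X` and the reference is close to a product state, then the code recovers from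
noise on `X`: by Uhlmann's theorem the subsystem `Z` alone can be mapped to a purification of that
product state, whose second factor is the encoded state. -/
theorem exists_decoder_of_decoupled [DecidableEq R] (e : S ≃ X × Z) (Φ : Matrix S R ℂ)
    (hΦ : ‖Φ‖ = 1) (Χ : Matrix X T ℂ) (hΧ : ‖Χ‖ = 1) :
    ∃ (m' : ℕ) (D : Fin m' → Matrix S S ℂ), IsChannel D ∧
      ∀ (m : ℕ) (B : Fin m → Matrix X X ℂ), IsChannel B →
        1 - √(Fintype.card (X × R)) *
            ‖reshape e Φ * (reshape e Φ)ᴴ - (Χ * Χᴴ) ⊗ₖ (Φᵀ * Φᵀᴴ)‖ ≤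
          recoveryFidelity D (fun l => ampliation e (B l)) (vec Φᵀ) := by
  obtain ⟨C, hC, hoverlap⟩ := exists_contraction_overlap (reshape e Φ) (Χ ⊗ₖ Φᵀ)
    (by rw [frobenius_norm_reshape, hΦ])
    (by rw [frobenius_norm_kronecker, frobenius_norm_transpose, hΦ, hΧ, one_mul])
  obtain ⟨m', D, f, hD, hDf⟩ := exists_isChannel_extending (decoderKraus e C)
    (sum_conjTranspose_mul_decoderKraus_le_one e hC)
  refine ⟨m', D, hD, fun m B hB => ?_⟩
  rw [trace_reshape_mul_kronecker, conjTranspose_kronecker, ← mul_kronecker_mul] at hoverlap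
  calc _ ≤ _ := hoverlap
    _ ≤ ‖Χ‖ ^ 2 * ‖of fun x t => (Φᴴ * decoderKraus e C (x, t) * Φ).trace‖ ^ 2 :=
        sq_norm_trace_conjTranspose_mul_le _ _
    _ = ∑ i, ∑ l, ‖(Φᴴ * (D (f i) * ampliation e (B l)) * Φ).trace‖ ^ 2 := by
        simp_rw [hΧ, one_pow, one_mul, hDf, sum_norm_sq_decoderKraus e Φ C hB]
    _ ≤ _ := sum_le_recoveryFidelity_vec D f _ Φ

end Decoder

/-! ### Approximate Knill–Laflamme conditions -/

section KnillLaflamme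

open scoped Matrix.Norms.Frobenius

variable {S X Z R ι : Type*} [Fintype S] [Fintype X] [Fintype Z]

lemma reshape_mul_conjTranspose_apply [DecidableEq S] [DecidableEq X] [DecidableEq Z]
    (e : S ≃ X × Z) (Φ : Matrix S R ℂ) (x y : X) (r r' : R) :
    (reshape e Φ * (reshape e Φ)ᴴ) (x, r) (y, r') =
      (Φᴴ * ampliation e (single y x 1) * Φ) r' r := by
  rw [conjTranspose_mul_ampliation_single_mul, Matrix.mul_apply, Matrix.mul_apply]
  refine Finset.sum_congr rfl fun z _ => ?_
  simp [reshape, bra_mul, mul_comm]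

variable [Fintype ι]

lemma frobenius_norm_sub_trace_smul_one_le [DecidableEq ι] [Nonempty ι] (M : Matrix ι ι ℂ)
    (a : ℂ) :
    ‖M - (M.trace / Fintype.card ι) • (1 : Matrix ι ι ℂ)‖ ≤ ‖M - a • (1 : Matrix ι ι ℂ)‖ := by
  set M₀ := M - (M.trace / Fintype.card ι) • (1 : Matrix ι ι ℂ)
  have htrace : M₀.trace = 0 := by simp [M₀]
  have hsplit : M - a • (1 : Matrix ι ι ℂ) =
      M₀ - (a - M.trace / Fintype.card ι) • (1 : Matrix ι ι ℂ) := by module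
  rw [hsplit, ← sq_le_sq₀ (norm_nonneg _) (norm_nonneg _), frobenius_norm_sub_sq M₀,
    conjTranspose_smul, conjTranspose_one, Matrix.mul_smul, Matrix.mul_one, trace_smul, htrace,
    smul_zero, Complex.zero_re]
  linarith [sq_nonneg ‖(a - M.trace / Fintype.card ι) • (1 : Matrix ι ι ℂ)‖]

/-- The amplitude matrix of the state of `X` when the code with encoding `V` is maximally mixed,
purified by `Z` and the label of the code word. -/
noncomputable def mixedCodeState (e : S ≃ X × Z) (V : Matrix S ι ℂ) : Matrix X (Z × ι) ℂ :=
  (√(Fintype.card ι))⁻¹ • of fun x j => V (e.symm (x, j.1)) j.2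

lemma mixedCodeState_mul_conjTranspose [DecidableEq S] [DecidableEq X] [DecidableEq Z]
    (e : S ≃ X × Z) (V : Matrix S ι ℂ) (x y : X) :
    (mixedCodeState e V * (mixedCodeState e V)ᴴ) x y =
      (Vᴴ * ampliation e (single y x 1) * V).trace / Fintype.card ι := by
  have hcard : ((√(Fintype.card ι : ℝ))⁻¹ : ℂ) * star ((√(Fintype.card ι : ℝ))⁻¹ : ℂ) =
      (Fintype.card ι : ℂ)⁻¹ := by
    rw [star_inv₀, RCLike.star_def, Complex.conj_ofReal, ← mul_inv, ← Complex.ofReal_mul,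
      Real.mul_self_sqrt (by positivity), Complex.ofReal_natCast]
  rw [conjTranspose_mul_ampliation_single_mul, trace_conjTranspose_mul, div_eq_inv_mul, ← hcard,
    Matrix.mul_apply, Fintype.sum_prod_type]
  simp only [Finset.mul_sum]
  refine Finset.sum_congr rfl fun z _ => Finset.sum_congr rfl fun i _ => ?_
  simp only [mixedCodeState, Matrix.smul_apply, of_apply, conjTranspose_apply, bra_mul,
    submatrix_apply, id_eq, Complex.real_smul, Complex.ofReal_inv, star_mul']
  ring

variable [Fintype R]

lemma frobenius_norm_mul_of_isometry [DecidableEq ι] {V : Matrix S ι ℂ} (hV : Vᴴ * V = 1)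
    (c : Matrix ι R ℂ) : ‖V * c‖ = ‖c‖ := by
  rw [← sq_eq_sq₀ (norm_nonneg _) (norm_nonneg _), ← Complex.ofReal_inj,
    frobenius_norm_sq_eq_trace, frobenius_norm_sq_eq_trace, conjTranspose_mul,
    Matrix.trace_mul_comm, Matrix.trace_mul_comm c, Matrix.mul_assoc, ← Matrix.mul_assoc Vᴴ, hV,
    Matrix.one_mul]

/-- The deviation from the Knill–Laflamme conditions `Vᴴ (|x⟩⟨y| ⊗ 1) V = a x y • 1` for the code
with isometric encoding `V` and noise on `X`, as a sum of squared Frobenius norms. -/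
noncomputable def knillLaflammeError [DecidableEq S] [DecidableEq X] [DecidableEq Z]
    [DecidableEq ι] (e : S ≃ X × Z) (V : Matrix S ι ℂ) (a : X → X → ℂ) : ℝ :=
  ∑ x, ∑ y, ‖Vᴴ * ampliation e (single x y 1) * V - a x y • (1 : Matrix ι ι ℂ)‖ ^ 2

lemma knillLaflammeError_nonneg [DecidableEq S] [DecidableEq X] [DecidableEq Z] [DecidableEq ι]
    (e : S ≃ X × Z) (V : Matrix S ι ℂ) (a : X → X → ℂ) : 0 ≤ knillLaflammeError e V a := by
  unfold knillLaflammeError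
  positivity

lemma frobenius_norm_mixedCodeState [DecidableEq ι] [Nonempty ι] (e : S ≃ X × Z)
    {V : Matrix S ι ℂ} (hV : Vᴴ * V = 1) : ‖mixedCodeState e V‖ = 1 := by
  have hreindex : ‖(of fun x j => V (e.symm (x, j.1)) j.2 : Matrix X (Z × ι) ℂ)‖ = ‖V‖ := by
    rw [← sq_eq_sq₀ (norm_nonneg _) (norm_nonneg _), frobenius_norm_sq, frobenius_norm_sq,
      ← Equiv.sum_comp e.symm, Fintype.sum_prod_type]
    simp only [of_apply, Fintype.sum_prod_type]
  have hnorm : ‖V‖ = √(Fintype.card ι) := by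
    rw [← Matrix.mul_one V, frobenius_norm_mul_of_isometry hV]
    simp [frobenius_norm_def, one_apply, Real.sqrt_eq_rpow, apply_ite norm, ite_pow]
  rw [mixedCodeState, norm_smul, hreindex, hnorm, norm_inv, Real.norm_of_nonneg (by positivity),
    inv_mul_cancel₀ (by positivity)]

lemma frobenius_norm_decoupling_sq_le [DecidableEq S] [DecidableEq X] [DecidableEq Z]
    [DecidableEq ι] [Nonempty ι] (e : S ≃ X × Z) {V : Matrix S ι ℂ} (hV : Vᴴ * V = 1)
    {c : Matrix ι R ℂ} (hc : ‖c‖ = 1) (a : X → X → ℂ) :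
    ‖reshape e (V * c) * (reshape e (V * c))ᴴ -
      (mixedCodeState e V * (mixedCodeState e V)ᴴ) ⊗ₖ ((V * c)ᵀ * (V * c)ᵀᴴ)‖ ^ 2 ≤
      knillLaflammeError e V a := by
  set M : X → X → Matrix ι ι ℂ := fun x y => Vᴴ * ampliation e (single x y 1) * V with hM
  have hentry (x y : X) (r r' : R) : (reshape e (V * c) * (reshape e (V * c))ᴴ -
      (mixedCodeState e V * (mixedCodeState e V)ᴴ) ⊗ₖ ((V * c)ᵀ * (V * c)ᵀᴴ)) (x, r) (y, r') =
      (cᴴ * (M y x - ((M y x).trace / Fintype.card ι) • (1 : Matrix ι ι ℂ)) * c) r' r := by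
    rw [Matrix.sub_apply, reshape_mul_conjTranspose_apply, kronecker_apply,
      mixedCodeState_mul_conjTranspose]
    have hcc : ((V * c)ᵀ * (V * c)ᵀᴴ) r r' = (cᴴ * c) r' r := by
      rw [← Matrix.mul_one cᴴ, ← hV, ← Matrix.mul_assoc, ← conjTranspose_mul, Matrix.mul_assoc]
      simp only [Matrix.mul_apply, transpose_apply, conjTranspose_apply, mul_comm]
    rw [hcc, conjTranspose_mul]
    simp [hM, Matrix.mul_sub, Matrix.sub_mul, Matrix.mul_assoc]
  calc _ = ∑ x, ∑ y,
          ‖cᴴ * (M x y - ((M x y).trace / Fintype.card ι) • (1 : Matrix ι ι ℂ)) * c‖ ^ 2 := by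
        simp_rw [frobenius_norm_sq, Fintype.sum_prod_type, hentry]
        rw [Finset.sum_comm (s := Finset.univ (α := X)) (t := Finset.univ (α := X))]
        refine Finset.sum_congr rfl fun x _ => Finset.sum_comm.trans ?_
        exact Finset.sum_congr rfl fun y _ => Finset.sum_comm
    _ ≤ knillLaflammeError e V a := by
        refine Finset.sum_le_sum fun x _ => Finset.sum_le_sum fun y _ => ?_
        gcongr
        calc _ ≤ ‖cᴴ‖ * ‖M x y - ((M x y).trace / Fintype.card ι) • (1 : Matrix ι ι ℂ)‖ * ‖c‖ := by
              refine (frobenius_norm_mul _ _).trans ?_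
              gcongr
              exact frobenius_norm_mul _ _
          _ ≤ _ := by
              rw [frobenius_norm_conjTranspose, hc, one_mul, mul_one]
              exact frobenius_norm_sub_trace_smul_one_le _ _

theorem exists_decoder_of_knillLaflammeError [DecidableEq S] [DecidableEq X] [DecidableEq Z]
    [DecidableEq R] [DecidableEq ι] [Nonempty ι] (e : S ≃ X × Z) {V : Matrix S ι ℂ}
    (hV : Vᴴ * V = 1) {c : Matrix ι R ℂ} (hc : ‖c‖ = 1) (a : X → X → ℂ) :
    ∃ (m' : ℕ) (D : Fin m' → Matrix S S ℂ), IsChannel D ∧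
      ∀ (m : ℕ) (B : Fin m → Matrix X X ℂ), IsChannel B →
        1 - √(Fintype.card (X × R) * knillLaflammeError e V a) ≤
          recoveryFidelity D (fun l => ampliation e (B l)) (vec (V * c)ᵀ) := by
  obtain ⟨m', D, hD, hrec⟩ := exists_decoder_of_decoupled e (V * c)
    (by rw [frobenius_norm_mul_of_isometry hV, hc]) (mixedCodeState e V)
    (frobenius_norm_mixedCodeState e hV)
  refine ⟨m', D, hD, fun m B hB => le_trans ?_ (hrec m B hB)⟩
  rw [Real.sqrt_mul (by positivity)]
  gcongr
  exact Real.le_sqrt_of_sq_le (frobenius_norm_decoupling_sq_le e hV hc a)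

end KnillLaflamme

/-! ### Codes on a line of qubits -/

section LocalOperators

variable {N : ℕ}

/-- Splits a configuration into its parts on `W` and on the complement of `W`. -/
def splitConf (W : Finset (Fin N)) : Conf N ≃ (W → Fin 2) × ({q // q ∉ W} → Fin 2) :=
  Equiv.piEquivPiSubtypeProd (fun q => q ∈ W) fun _ => Fin 2

lemma supportedOn_iff_exists_ampliation {W : Finset (Fin N)} {A : Op N} :
    SupportedOn W A ↔ ∃ B, ampliation (splitConf W) B = A := by
  refine exists_congr fun B => ⟨fun h => ?_, ?_⟩
  · ext x y
    rw [h, ampliation_apply, one_apply]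
    simp [splitConf, funext_iff]
  · rintro rfl x y
    rw [ampliation_apply, one_apply]
    simp [splitConf, funext_iff]

lemma card_window_le (N d a : ℕ) : (window N d a).card ≤ d := by
  have hIco : (window N d a).card ≤ (Finset.Ico a (a + d)).card :=
    Finset.card_le_card_of_injOn (fun q => (q : ℕ)) (fun q hq => by simpa [window] using hq)
      Fin.val_injective.injOn
  simpa using hIco

lemma card_window_conf_prod_le (N d a k : ℕ) :
    (Fintype.card ((window N d a → Fin 2) × Fin (2 ^ k)) : ℝ) ≤ 2 ^ (d + k) := by
  have hpow : (2 : ℝ) ^ (window N d a).card ≤ 2 ^ d :=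
    pow_le_pow_right₀ one_le_two (card_window_le N d a)
  simpa [pow_add] using hpow

lemma window_eq_of_le {a : ℕ} (d : ℕ) (h : N ≤ a) : window N d a = window N d N := by
  ext q
  simp only [window, Finset.mem_filter_univ]
  have := q.2
  omega

lemma ampliation_injective {S X Z : Type*} [Fintype S] [Fintype X] [Fintype Z] [DecidableEq S]
    [DecidableEq X] [DecidableEq Z] [Nonempty Z] (e : S ≃ X × Z) :
    Function.Injective (ampliation e) := by
  intro B B' h
  ext x y
  obtain ⟨z⟩ := ‹Nonempty Z›
  simpa [ampliation_apply, one_apply] using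
    congrFun (congrFun h (e.symm (x, z))) (e.symm (y, z))

lemma IsChannel.of_ampliation {S X Z : Type*} [Fintype S] [Fintype X] [Fintype Z] [DecidableEq S]
    [DecidableEq X] [DecidableEq Z] [Nonempty Z] {e : S ≃ X × Z} {m : ℕ}
    {B : Fin m → Matrix X X ℂ} (h : IsChannel fun l => ampliation e (B l)) : IsChannel B := by
  refine ampliation_injective e ?_
  simpa only [IsChannel, map_sum, map_mul, map_one, ← star_eq_conjTranspose, map_star] using h

end LocalOperators

section Codes

open scoped Matrix.Norms.Frobenius

variable {N k d : ℕ}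

lemma finrank_range_mulVecLin_of_isometry {S ι : Type*} [Fintype S] [Fintype ι] [DecidableEq ι]
    {V : Matrix S ι ℂ} (hV : Vᴴ * V = 1) :
    Module.finrank ℂ (LinearMap.range V.mulVecLin) = Fintype.card ι := by
  have hinj : Function.Injective V.mulVecLin :=
    Function.LeftInverse.injective (g := fun u => Vᴴ *ᵥ u) fun u => by simp [mulVec_mulVec, hV]
  rw [LinearMap.finrank_range_of_inj hinj, Module.finrank_fintype_fun_eq_card]

lemma exists_eq_vec_of_mem_range_mulVecLin {S R ι : Type*} [Fintype S] [Fintype R] [Fintype ι]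
    [DecidableEq ι] {V : Matrix S ι ℂ} (hV : Vᴴ * V = 1) {ψ : S × R → ℂ}
    (hmem : ∀ r, (fun x => ψ (x, r)) ∈ LinearMap.range V.mulVecLin) (hψ : star ψ ⬝ᵥ ψ = 1) :
    ∃ c : Matrix ι R ℂ, ‖c‖ = 1 ∧ vec (V * c)ᵀ = ψ := by
  choose u hu using hmem
  have hvec : vec (V * (of u)ᵀ)ᵀ = ψ := funext fun i => congrFun (hu i.2) i.1
  refine ⟨(of u)ᵀ, ?_, hvec⟩
  rw [← frobenius_norm_mul_of_isometry hV, ← sq_eq_sq₀ (norm_nonneg _) zero_le_one, one_pow,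
    ← Complex.ofReal_inj, frobenius_norm_sq_eq_trace, Complex.ofReal_one, ← hψ, ← hvec,
    star_vec_dotProduct_vec,
    conjTranspose_transpose_eq_transpose_conjTranspose, ← transpose_mul, trace_transpose]

theorem isAQECC_of_knillLaflammeError_le {V : Matrix (Conf N) (Fin (2 ^ k)) ℂ} (hV : Vᴴ * V = 1)
    {Y : ℝ} (hY : ∀ a, ∃ A, knillLaflammeError (splitConf (window N d a)) V A ≤ Y) :
    IsAQECC k d √(2 ^ (d + k) * Y) (LinearMap.range V.mulVecLin) := by
  refine ⟨by rw [finrank_range_mulVecLin_of_isometry hV, Fintype.card_fin], ?_⟩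
  intro a m K hK hsupp ψ hmem hψ
  obtain ⟨A, hA⟩ := hY a
  obtain ⟨c, hc, rfl⟩ := exists_eq_vec_of_mem_range_mulVecLin hV hmem hψ
  simp only [supportedOn_iff_exists_ampliation] at hsupp
  choose B hB using hsupp
  obtain rfl : (fun l => ampliation (splitConf (window N d a)) (B l)) = K := funext hB
  obtain ⟨m', D, hD, hrec⟩ :=
    exists_decoder_of_knillLaflammeError (splitConf (window N d a)) hV hc A
  refine ⟨m', D, hD, le_trans ?_ (hrec m B hK.of_ampliation)⟩
  refine sub_le_sub_left (Real.sqrt_le_sqrt ?_) 1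
  exact mul_le_mul (card_window_conf_prod_le N d a k) hA (knillLaflammeError_nonneg _ V A)
    (pow_nonneg zero_le_two _)

lemma isAQECC_one {C : Submodule ℂ (Conf N → ℂ)} (hC : Module.finrank ℂ C = 2 ^ k) :
    IsAQECC k d 1 C := by
  refine ⟨hC, fun a m K _ _ ψ _ _ => ⟨1, fun _ => 1, by simp [IsChannel], ?_⟩⟩
  simpa using recoveryFidelity_nonneg _ K ψ

lemma codeError_le {C : Submodule ℂ (Conf N → ℂ)} {ε : ℝ} (hε : 0 ≤ ε) (h : IsAQECC k d ε C) :
    codeError k d C ≤ ε :=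
  csInf_le ⟨0, fun _ hx => hx.1⟩ ⟨hε, h⟩

end Codes

/-! ### Thermal observables -/

section Observables

open scoped Matrix.Norms.L2Operator ComplexStarModule

lemma l2_opNorm_single_one_le {X : Type*} [Fintype X] [DecidableEq X] (x y : X) :
    ‖(single x y 1 : Matrix X X ℂ)‖ ≤ 1 := by
  rw [← sq_le_one_iff₀ (norm_nonneg _), sq, ← l2_opNorm_conjTranspose_mul_self,
    conjTranspose_single, single_mul_single_same, star_one, one_mul, ← diagonal_single,
    l2_opNorm_diagonal, Pi.norm_single, norm_one]

lemma l2_opNorm_ampliation_single_one_le {S X Z : Type*} [Fintype S] [Fintype X] [Fintype Z]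
    [DecidableEq S] [DecidableEq X] [DecidableEq Z] (e : S ≃ X × Z) (x y : X) :
    ‖ampliation e (single x y 1)‖ ≤ 1 :=
  (NonUnitalStarAlgHom.norm_apply_le (ampliation e) _).trans (l2_opNorm_single_one_le x y)

lemma SupportedOn.exists_localObservables {N d a : ℕ} {A : Op N}
    (hA : SupportedOn (window N d a) A) (hA1 : ‖toEuclideanCLM (𝕜 := ℂ) A‖ ≤ 1) :
    ∃ A₁ A₂ : Op N, (IsLocalObservable d A₁ ∧ ‖toEuclideanCLM (𝕜 := ℂ) A₁‖ ≤ 1) ∧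
      (IsLocalObservable d A₂ ∧ ‖toEuclideanCLM (𝕜 := ℂ) A₂‖ ≤ 1) ∧
      A₁ + Complex.I • A₂ = A := by
  simp only [← cstar_norm_def] at hA1 ⊢
  obtain ⟨B, hB⟩ := supportedOn_iff_exists_ampliation.mp hA
  have hre : SupportedOn (window N d a) (ℜ A : Op N) :=
    supportedOn_iff_exists_ampliation.mpr ⟨ℜ B, by rw [← hB, map_realPart]⟩
  have him : SupportedOn (window N d a) (ℑ A : Op N) :=
    supportedOn_iff_exists_ampliation.mpr ⟨ℑ B, by rw [← hB, map_imaginaryPart]⟩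
  exact ⟨ℜ A, ℑ A, ⟨⟨(ℜ A).2, a, hre⟩, (realPart.norm_le A).trans hA1⟩,
    ⟨⟨(ℑ A).2, a, him⟩, (imaginaryPart.norm_le A).trans hA1⟩, realPart_add_I_smul_imaginaryPart A⟩

end Observables

namespace Ensemble

variable {N : ℕ} {Ω : Type*} [MeasurableSpace Ω]

lemma entropy_nonneg (Q : Ensemble N Ω) (E₀ Δ : ℝ) : 0 ≤ Q.entropy E₀ Δ :=
  Real.log_natCast_nonneg _

lemma abs_sub_le_of_mem_shell {Q : Ensemble N Ω} {E₀ Δ : ℝ} {i j : Conf N}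
    (hi : i ∈ Q.shell E₀ Δ) (hj : j ∈ Q.shell E₀ Δ) : |Q.E i - Q.E j| ≤ 2 * |Δ| := by
  simp only [shell, Finset.mem_filter_univ] at hi hj
  calc |Q.E i - Q.E j| ≤ |Q.E i - E₀| + |E₀ - Q.E j| := abs_sub_le _ _ _
    _ ≤ |Δ| + |Δ| := by
      rw [abs_sub_comm E₀]
      exact add_le_add (hi.trans (le_abs_self Δ)) (hj.trans (le_abs_self Δ))
    _ = 2 * |Δ| := (two_mul _).symm

lemma measurable_matrixElement (Q : Ensemble N Ω) (A : Op N) (i j : Conf N) :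
    Measurable (Q.matrixElement A i j) := by
  unfold matrixElement
  simp only [mul_apply, conjTranspose_apply]
  refine Finset.measurable_sum _ fun y _ => Measurable.mul (Finset.measurable_sum _ fun x _ => ?_)
    (Q.measurable y j)
  exact (continuous_star.measurable.comp (Q.measurable x i)).mul_const _

/-- On the eigenstates with labels in `T`, the observable `A` is a multiple of the identity up to
fluctuations of its matrix elements of root mean square at most `σ`. -/
def IsThermal (Q : Ensemble N Ω) (P : Measure Ω) (T : Finset (Conf N)) (σ : ENNReal)
    (A : Op N) : Prop :=
  ∃ a : ℂ, ∀ i ∈ T, ∀ j ∈ T,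
    eLpNorm (fun o => Q.matrixElement A i j o - if i = j then a else 0) 2 P ≤ σ

variable {Q : Ensemble N Ω} {P : Measure Ω} {T : Finset (Conf N)} {σ σ₁ σ₂ : ENNReal}
  {A A₁ A₂ : Op N}

lemma IsThermal.add (h₁ : Q.IsThermal P T σ₁ A₁) (h₂ : Q.IsThermal P T σ₂ A₂) :
    Q.IsThermal P T (σ₁ + σ₂) (A₁ + A₂) := by
  obtain ⟨a₁, ha₁⟩ := h₁
  obtain ⟨a₂, ha₂⟩ := h₂
  refine ⟨a₁ + a₂, fun i hi j hj => ?_⟩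
  have hsplit : (fun o => Q.matrixElement (A₁ + A₂) i j o - if i = j then a₁ + a₂ else 0) =
      (fun o => Q.matrixElement A₁ i j o - if i = j then a₁ else 0) +
        fun o => Q.matrixElement A₂ i j o - if i = j then a₂ else 0 := by
    funext o
    simp only [matrixElement, Matrix.mul_add, Matrix.add_mul, Matrix.add_apply, Pi.add_apply]
    split_ifs <;> ring
  rw [hsplit]
  refine (eLpNorm_add_le ?_ ?_ one_le_two).trans (add_le_add (ha₁ i hi j hj) (ha₂ i hi j hj))
  · exact ((Q.measurable_matrixElement A₁ i j).sub_const _).aestronglyMeasurable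
  · exact ((Q.measurable_matrixElement A₂ i j).sub_const _).aestronglyMeasurable

lemma IsThermal.const_smul (h : Q.IsThermal P T σ A) (z : ℂ) :
    Q.IsThermal P T (‖z‖ₑ * σ) (z • A) := by
  obtain ⟨a, ha⟩ := h
  refine ⟨z * a, fun i hi j hj => ?_⟩
  have hfactor : (fun o => Q.matrixElement (z • A) i j o - if i = j then z * a else 0) =
      z • fun o => Q.matrixElement A i j o - if i = j then a else 0 := by
    funext o
    simp only [matrixElement, Matrix.mul_smul, Matrix.smul_mul, Matrix.smul_apply, smul_eq_mul,
      Pi.smul_apply, mul_sub, mul_ite, mul_zero]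
  rw [hfactor, eLpNorm_const_smul]
  exact mul_le_mul_right (ha i hi j hj) _

variable {d : ℕ} {E₀ Δ β c : ℝ}

/-- The bound on the root mean square fluctuations of matrix elements in a shell of half-width `Δ`
and entropy `S`, for a spectral function bounded by `c * exp (-β |ω| / 4)`. -/
noncomputable def fluctuationBound (Q : Ensemble N Ω) (E₀ Δ β c : ℝ) : ℝ :=
  c * Real.exp (|β| * |Δ| / 2 - Q.entropy E₀ Δ / 2)

lemma exp_mul_abs_le_fluctuationBound (Q : Ensemble N Ω) {w v : ℝ}
    (hv : |v| ≤ c * Real.exp (-(β / 4) * |w|)) (hw : |w| ≤ 2 * |Δ|) :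
    |Real.exp (-Q.entropy E₀ Δ / 2) * v| ≤ Q.fluctuationBound E₀ Δ β c := by
  have hc : 0 ≤ c := nonneg_of_mul_nonneg_left ((abs_nonneg v).trans hv) (Real.exp_pos _)
  have hexponent : -(β / 4) * |w| ≤ |β| * |Δ| / 2 := by
    nlinarith [neg_abs_le β, mul_le_mul_of_nonneg_left hw (abs_nonneg β), abs_nonneg w]
  calc |Real.exp (-Q.entropy E₀ Δ / 2) * v|
      = Real.exp (-Q.entropy E₀ Δ / 2) * |v| := by rw [abs_mul, Real.abs_exp]
    _ ≤ Real.exp (-Q.entropy E₀ Δ / 2) * (c * Real.exp (|β| * |Δ| / 2)) := by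
      gcongr
      exact hv.trans (by gcongr)
    _ = Q.fluctuationBound E₀ Δ β c := by
      rw [fluctuationBound, sub_eq_add_neg, Real.exp_add, neg_div]
      ring

lemma SatisfiesETH.mono {c' : ℝ} (h : Q.SatisfiesETH P d E₀ Δ β c) (hc : c ≤ c') :
    Q.SatisfiesETH P d E₀ Δ β c' := by
  intro A hA hA1
  obtain ⟨Abar, f, R, hAbar, hfsmooth, hf, hR⟩ := h A hA hA1
  exact ⟨Abar, f, R, hAbar, hfsmooth, fun w => (hf w).trans (by gcongr), hR⟩

lemma SatisfiesETH.isThermal (h : Q.SatisfiesETH P d E₀ Δ β c) (hA : IsLocalObservable d A)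
    (hA1 : ‖toEuclideanCLM (𝕜 := ℂ) A‖ ≤ 1) :
    Q.IsThermal P (Q.shell E₀ Δ) (ENNReal.ofReal (Q.fluctuationBound E₀ Δ β c)) A := by
  obtain ⟨Abar, f, R, -, -, hf, hR⟩ := h A hA hA1
  refine ⟨Abar E₀, fun i hi j hj => ?_⟩
  obtain ⟨hL2, -, hvar, hae⟩ := hR i hi j hj
  set b : ℝ := Real.exp (-Q.entropy E₀ Δ / 2) * f (E₀, Q.E i - Q.E j)
  have hfluct : (fun o => Q.matrixElement A i j o - if i = j then (Abar E₀ : ℂ) else 0) =ᵐ[P]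
      (b : ℂ) • R i j := by
    filter_upwards [hae] with o ho
    rw [ho, add_sub_cancel_left, Pi.smul_apply, smul_eq_mul]
  have hnorm : eLpNorm (R i j) 2 P = 1 := by
    rw [hL2.eLpNorm_eq_integral_rpow_norm two_ne_zero ENNReal.ofNat_ne_top]
    simp [hvar]
  rw [eLpNorm_congr_ae hfluct, eLpNorm_const_smul, hnorm, mul_one, ← ofReal_norm,
    Complex.norm_real, Real.norm_eq_abs]
  exact ENNReal.ofReal_le_ofReal <|
    exp_mul_abs_le_fluctuationBound Q (hf _) (abs_sub_le_of_mem_shell hi hj)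

lemma SatisfiesETH.isThermal_of_supportedOn (h : Q.SatisfiesETH P d E₀ Δ β c) {a : ℕ}
    (hA : SupportedOn (window N d a) A) (hA1 : ‖toEuclideanCLM (𝕜 := ℂ) A‖ ≤ 1) :
    Q.IsThermal P (Q.shell E₀ Δ) (2 * ENNReal.ofReal (Q.fluctuationBound E₀ Δ β c)) A := by
  obtain ⟨A₁, A₂, ⟨hA₁, hn₁⟩, ⟨hA₂, hn₂⟩, rfl⟩ := hA.exists_localObservables hA1
  have hI := (h.isThermal hA₂ hn₂).const_smul Complex.I
  rw [← ofReal_norm, Complex.norm_I, ENNReal.ofReal_one, one_mul] at hI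
  exact two_mul (ENNReal.ofReal _) ▸ (h.isThermal hA₁ hn₁).add hI

end Ensemble

/-! ### The code error of an ensemble -/

lemma eLpNorm_two_sq_eq_lintegral {Ω E : Type*} [MeasurableSpace Ω] {μ : Measure Ω}
    [NormedAddCommGroup E] (f : Ω → E) : eLpNorm f 2 μ ^ 2 = ∫⁻ o, ‖f o‖ₑ ^ 2 ∂μ := by
  simpa using eLpNorm_nnreal_pow_eq_lintegral (μ := μ) (f := f) (p := 2) two_ne_zero

namespace Ensemble

variable {N d k : ℕ} {Ω : Type*} [MeasurableSpace Ω] {Q : Ensemble N Ω} {P : Measure Ω}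
  {T : Finset (Conf N)}

lemma conjTranspose_mul_submatrix_eigenvectors (Q : Ensemble N Ω) {ι : Type*} [DecidableEq ι]
    (s : ι ↪ Conf N) (o : Ω) :
    ((Q.V o).submatrix id s)ᴴ * (Q.V o).submatrix id s = 1 := by
  rw [conjTranspose_submatrix, ← submatrix_mul _ _ _ _ _ Function.bijective_id,
    ← star_eq_conjTranspose, mem_unitaryGroup_iff'.mp (Q.unitary o), submatrix_one_embedding]

lemma codeSpace_eq_range_mulVecLin (Q : Ensemble N Ω) {K : ℕ} (s : Fin K ↪ Conf N) (o : Ω) :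
    Q.codeSpace s o = LinearMap.range ((Q.V o).submatrix id s).mulVecLin :=
  (range_mulVecLin _).symm

lemma codeError_codeSpace_le_one (Q : Ensemble N Ω) (s : Fin (2 ^ k) ↪ Conf N) (o : Ω) :
    codeError k d (Q.codeSpace s o) ≤ 1 := by
  rw [codeSpace_eq_range_mulVecLin]
  refine codeError_le zero_le_one (isAQECC_one ?_)
  rw [finrank_range_mulVecLin_of_isometry (Q.conjTranspose_mul_submatrix_eigenvectors s o),
    Fintype.card_fin]

lemma codeError_codeSpace_le (s : Fin (2 ^ k) ↪ Conf N) {o : Ω} {Y : ℝ}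
    (hY : ∀ a ≤ N, ∃ A,
      knillLaflammeError (splitConf (window N d a)) ((Q.V o).submatrix id s) A ≤ Y) :
    codeError k d (Q.codeSpace s o) ≤ √(2 ^ (d + k) * Y) := by
  rw [codeSpace_eq_range_mulVecLin]
  refine codeError_le (Real.sqrt_nonneg _) (isAQECC_of_knillLaflammeError_le
    (Q.conjTranspose_mul_submatrix_eigenvectors s o) fun a => ?_)
  rcases le_total a N with ha | ha
  · exact hY a ha
  · rw [window_eq_of_le d ha]
    exact hY N le_rfl

variable {X Z ι : Type*} [Fintype X] [Fintype Z] [Fintype ι] [DecidableEq X] [DecidableEq Z]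
  [DecidableEq ι]

lemma knillLaflammeError_submatrix_eigenvectors (e : Conf N ≃ X × Z) (s : ι ↪ Conf N)
    (a : X → X → ℂ) (o : Ω) :
    knillLaflammeError e ((Q.V o).submatrix id s) a = ∑ p : X × ι, ∑ q : X × ι,
      ‖Q.matrixElement (ampliation e (single p.1 q.1 1)) (s p.2) (s q.2) o -
        if s p.2 = s q.2 then a p.1 q.1 else 0‖ ^ 2 := by
  simp only [knillLaflammeError, frobenius_norm_sq, Matrix.sub_apply, Matrix.smul_apply, one_apply,
    smul_eq_mul, mul_ite, mul_one, mul_zero, s.injective.eq_iff, Fintype.sum_prod_type]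
  exact Finset.sum_congr rfl fun x _ => Finset.sum_comm

lemma measurable_knillLaflammeError (Q : Ensemble N Ω) (e : Conf N ≃ X × Z) (s : ι ↪ Conf N)
    (a : X → X → ℂ) :
    Measurable fun o => knillLaflammeError e ((Q.V o).submatrix id s) a := by
  simp only [knillLaflammeError_submatrix_eigenvectors]
  exact Finset.measurable_sum _ fun p _ => Finset.measurable_sum _ fun q _ =>
    ((Q.measurable_matrixElement _ _ _).sub_const _).norm.pow_const 2

lemma exists_lintegral_knillLaflammeError_le {σ : ENNReal} (e : Conf N ≃ X × Z)
    (h : ∀ x y, Q.IsThermal P T σ (ampliation e (single x y 1))) (s : ι ↪ Conf N)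
    (hs : ∀ r, s r ∈ T) :
    ∃ a, ∫⁻ o, ENNReal.ofReal (knillLaflammeError e ((Q.V o).submatrix id s) a) ∂P ≤
      Fintype.card (X × ι) ^ 2 * σ ^ 2 := by
  choose a ha using h
  refine ⟨a, ?_⟩
  set D : X × ι → X × ι → Ω → ℂ := fun p q o =>
    Q.matrixElement (ampliation e (single p.1 q.1 1)) (s p.2) (s q.2) o -
      if s p.2 = s q.2 then a p.1 q.1 else 0
  have hD (p q : X × ι) : Measurable (D p q) := (Q.measurable_matrixElement _ _ _).sub_const _
  calc ∫⁻ o, ENNReal.ofReal (knillLaflammeError e ((Q.V o).submatrix id s) a) ∂P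
      = ∫⁻ o, ∑ p, ∑ q, ‖D p q o‖ₑ ^ 2 ∂P := by
        refine lintegral_congr fun o => ?_
        rw [knillLaflammeError_submatrix_eigenvectors,
          ENNReal.ofReal_sum_of_nonneg fun _ _ => by positivity]
        refine Finset.sum_congr rfl fun p _ => ?_
        rw [ENNReal.ofReal_sum_of_nonneg fun _ _ => by positivity]
        refine Finset.sum_congr rfl fun q _ => ?_
        rw [ENNReal.ofReal_pow (norm_nonneg _), ofReal_norm]
    _ = ∑ p, ∑ q, eLpNorm (D p q) 2 P ^ 2 := by
        rw [lintegral_finsetSum _ fun p _ => Finset.measurable_sum _ fun q _ =>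
          (hD p q).enorm.pow_const 2]
        refine Finset.sum_congr rfl fun p _ => ?_
        rw [lintegral_finsetSum _ fun q _ => (hD p q).enorm.pow_const 2]
        exact Finset.sum_congr rfl fun q _ => (eLpNorm_two_sq_eq_lintegral (D p q)).symm
    _ ≤ ∑ _p : X × ι, ∑ _q : X × ι, σ ^ 2 := by
        gcongr with p _ q _
        exact ha _ _ _ (hs _) _ (hs _)
    _ = Fintype.card (X × ι) ^ 2 * σ ^ 2 := by
        simp only [Finset.sum_const, Finset.card_univ, nsmul_eq_mul]
        ring

variable {σ : ℝ}

lemma exists_prob_knillLaflammeError_gt_le (hσ : 0 < σ) (a : ℕ)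
    (h : ∀ x y, Q.IsThermal P T (ENNReal.ofReal σ)
      (ampliation (splitConf (window N d a)) (single x y 1)))
    (s : Fin (2 ^ k) ↪ Conf N) (hs : ∀ r, s r ∈ T) :
    ∃ b, P {o | (2 ^ (d + k) * ((N + 1) * σ)) ^ 2 <
      knillLaflammeError (splitConf (window N d a)) ((Q.V o).submatrix id s) b} ≤
        ENNReal.ofReal (1 / (N + 1) ^ 2) := by
  obtain ⟨b, hb⟩ := exists_lintegral_knillLaflammeError_le _ h s hs
  refine ⟨b, ?_⟩
  set Y : ℝ := (2 ^ (d + k) * ((N + 1) * σ)) ^ 2 with hY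
  have hY0 : 0 < Y := by positivity
  have hmean : ∫⁻ o, ENNReal.ofReal (knillLaflammeError (splitConf (window N d a))
      ((Q.V o).submatrix id s) b) ∂P ≤ ENNReal.ofReal (2 ^ (d + k) * σ) ^ 2 := by
    refine hb.trans ?_
    rw [← mul_pow, ENNReal.ofReal_mul (by positivity), ← ENNReal.ofReal_natCast]
    gcongr
    exact card_window_conf_prod_le N d a k
  calc P {o | Y < knillLaflammeError (splitConf (window N d a)) ((Q.V o).submatrix id s) b}
      ≤ P {o | ENNReal.ofReal Y ≤ ENNReal.ofReal
          (knillLaflammeError (splitConf (window N d a)) ((Q.V o).submatrix id s) b)} :=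
        measure_mono fun o ho => ENNReal.ofReal_le_ofReal (le_of_lt ho)
    _ ≤ ENNReal.ofReal (2 ^ (d + k) * σ) ^ 2 / ENNReal.ofReal Y :=
        (meas_ge_le_lintegral_div
          (Q.measurable_knillLaflammeError _ s b).ennreal_ofReal.aemeasurable
          (ENNReal.ofReal_pos.mpr hY0).ne' ENNReal.ofReal_ne_top).trans
          (ENNReal.div_le_div_right hmean _)
    _ = ENNReal.ofReal (1 / (N + 1) ^ 2) := by
        rw [← ENNReal.ofReal_pow (by positivity), ← ENNReal.ofReal_div_of_pos hY0, hY]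
        congr 1
        field_simp

theorem prob_codeError_le [IsProbabilityMeasure P] (hσ : 0 < σ)
    (h : ∀ a x y, Q.IsThermal P T (ENNReal.ofReal σ)
      (ampliation (splitConf (window N d a)) (single x y 1)))
    (s : Fin (2 ^ k) ↪ Conf N) (hs : ∀ r, s r ∈ T) :
    1 - ENNReal.ofReal (1 / (N + 1)) ≤
      P {o | codeError k d (Q.codeSpace s o) ≤ √(2 ^ (3 * (d + k)) * ((N + 1) * σ) ^ 2)} := by
  choose b hb using fun a => exists_prob_knillLaflammeError_gt_le hσ a (h a) s hs
  set Y : ℝ := (2 ^ (d + k) * ((N + 1) * σ)) ^ 2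
  set bad : ℕ → Set Ω := fun a =>
    {o | Y < knillLaflammeError (splitConf (window N d a)) ((Q.V o).submatrix id s) (b a)}
  have hbad : P (⋃ a ∈ Finset.range (N + 1), bad a) ≤ ENNReal.ofReal (1 / (N + 1)) := by
    refine (measure_biUnion_finset_le _ _).trans ((Finset.sum_le_sum fun a _ => hb a).trans_eq ?_)
    rw [Finset.sum_const, Finset.card_range, ← ENNReal.ofReal_nsmul]
    congr 1
    push_cast [nsmul_eq_mul]
    field_simp
  have hmeas : MeasurableSet (⋃ a ∈ Finset.range (N + 1), bad a) :=
    Finset.measurableSet_biUnion _ fun a _ =>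
      measurableSet_lt measurable_const (Q.measurable_knillLaflammeError _ s _)
  have hgood : (⋃ a ∈ Finset.range (N + 1), bad a)ᶜ ⊆
      {o | codeError k d (Q.codeSpace s o) ≤ √(2 ^ (3 * (d + k)) * ((N + 1) * σ) ^ 2)} := by
    intro o ho
    simp only [bad, Set.mem_compl_iff, Set.mem_iUnion, Finset.mem_range_succ_iff,
      Set.mem_ofPred_eq, not_exists, not_lt] at ho
    refine (codeError_codeSpace_le s fun a ha => ⟨b a, ho a ha⟩).trans_eq (congrArg Real.sqrt ?_)
    rw [mul_comm 3, pow_mul]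
    ring
  calc 1 - ENNReal.ofReal (1 / (N + 1))
      ≤ 1 - P (⋃ a ∈ Finset.range (N + 1), bad a) := tsub_le_tsub_left hbad 1
    _ = P (⋃ a ∈ Finset.range (N + 1), bad a)ᶜ := (prob_compl_eq_one_sub hmeas).symm
    _ ≤ _ := measure_mono hgood

end Ensemble

section Asymptotics

lemma isLittleO_log_mul_add_one {a : ℝ} (ha : 0 < a) :
    (fun n : ℕ => Real.log (a * (n + 1))) =o[atTop] fun n : ℕ => (n : ℝ) := by
  have htop : Tendsto (fun n : ℕ => a * ((n : ℝ) + 1)) atTop atTop :=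
    (tendsto_natCast_atTop_atTop.atTop_add tendsto_const_nhds).const_mul_atTop ha
  refine (Real.isLittleO_log_id_atTop.comp_tendsto htop).trans_isBigO (IsBigO.const_mul_left ?_ a)
  exact (isBigO_refl _ _).add (isLittleO_const_id_atTop (1 : ℝ) |>.natCast_atTop).isBigO

lemma eventually_subextensive_lt {N : ℕ → ℕ} (hN : Tendsto N atTop atTop) {Δ S : ℕ → ℝ}
    (hΔ : Δ =o[atTop] fun n => (N n : ℝ)) (hS : (fun n => (N n : ℝ)) =O[atTop] S)
    (hS0 : ∀ n, 0 ≤ S n) (b b' : ℝ) {a : ℝ} (ha : 0 < a) {δ : ℝ} (hδ : 0 < δ) :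
    ∀ᶠ n in atTop, b * |Δ n| + b' * Real.log (a * (N n + 1)) < δ * S n := by
  have hsub : (fun n => b * |Δ n| + b' * Real.log (a * (N n + 1))) =o[atTop] S :=
    ((hΔ.abs_left.const_mul_left b).add
      (((isLittleO_log_mul_add_one ha).comp_tendsto hN).const_mul_left b')).trans_isBigO hS
  filter_upwards [hsub.def (half_pos hδ), hS.eq_zero_imp, hN.eventually_ge_atTop 1]
    with n hn hzero hN1
  have hSpos : 0 < S n := (hS0 n).lt_of_ne' fun h => by
    have : N n = 0 := by exact_mod_cast hzero h
    omega
  rw [Real.norm_of_nonneg (hS0 n)] at hn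
  linarith [(le_abs_self _).trans hn, mul_pos hδ hSpos]

lemma neg_log_le_two_mul_log_div {ε x : ℝ} {d k : ℕ} (hε : 0 < ε) (hx : 0 < x) (hε1 : ε ≤ 1)
    (hεx : ε ≤ √(2 ^ (3 * (d + k)) * x ^ 2)) :
    -(4 / 3) * Real.log x ≤ 2 * Real.log (2 ^ (d + 2 * k) / ε) := by
  have hlog1 : Real.log ε ≤ 0 := Real.log_nonpos hε.le hε1
  have hlogx : Real.log ε ≤ 3 / 2 * (d + k) * Real.log 2 + Real.log x := by
    refine (Real.log_le_log hε hεx).trans_eq ?_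
    rw [Real.log_sqrt (by positivity), Real.log_mul (by positivity) (by positivity),
      Real.log_pow, Real.log_pow]
    push_cast
    ring
  have hk : 0 ≤ k * Real.log 2 := by positivity
  rw [Real.log_div (by positivity) hε.ne', Real.log_pow]
  push_cast
  -- Weights `2 / 3` and `1 / 3` on the two bounds of `log ε` cancel the terms with `d`.
  linarith

lemma pos_and_pi_mul_abs_div_le {w Δ lam D : ℝ} (hlam : 0 < lam) (hw : |w| ≤ 2 * |Δ|)
    (hD : 2 * Real.pi / lam * |Δ| < D) : 0 < D ∧ Real.pi * |w| / D ≤ lam := by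
  have hD0 : 0 < D := lt_of_le_of_lt (by positivity) hD
  refine ⟨hD0, (div_le_iff₀ hD0).mpr ?_⟩
  calc Real.pi * |w| ≤ Real.pi * (2 * |Δ|) := by gcongr
    _ = lam * (2 * Real.pi / lam * |Δ|) := by field_simp
    _ ≤ lam * D := by gcongr

lemma tendsto_measure_one_of_eventually_ge {N : ℕ → ℕ} (hN : Tendsto N atTop atTop)
    {Ω : ℕ → Type*} [∀ n, MeasurableSpace (Ω n)] {P : ∀ n, Measure (Ω n)}
    [∀ n, IsProbabilityMeasure (P n)] {A : ∀ n, Set (Ω n)}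
    (hA : ∀ᶠ n in atTop, 1 - ENNReal.ofReal (1 / (N n + 1)) ≤ P n (A n)) :
    Tendsto (fun n => P n (A n)) atTop (𝓝 1) := by
  have hzero := ENNReal.tendsto_ofReal (tendsto_one_div_add_atTop_nhds_zero_nat.comp hN)
  have hlower : Tendsto (fun n => 1 - ENNReal.ofReal (1 / ((N n : ℝ) + 1))) atTop (𝓝 1) := by
    simpa using ENNReal.Tendsto.sub tendsto_const_nhds hzero (Or.inl ENNReal.one_ne_top)
  exact tendsto_of_tendsto_of_tendsto_of_le_of_le' hlower tendsto_const_nhds hA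
    (Eventually.of_forall fun n => prob_le_one)

end Asymptotics

namespace Ensemble

variable {N d k : ℕ} {Ω : Type*} [MeasurableSpace Ω] {Q : Ensemble N Ω} {P : Measure Ω}
  [IsProbabilityMeasure P] {E₀ Δ β c : ℝ}

theorem SatisfiesETH.prob_le_log_div_codeError (h : Q.SatisfiesETH P d E₀ Δ β c) (hc : 0 < c)
    (s : Fin (2 ^ k) ↪ Conf N) (hs : ∀ r, s r ∈ Q.shell E₀ Δ) :
    1 - ENNReal.ofReal (1 / (N + 1)) ≤ P {o | 0 < codeError k d (Q.codeSpace s o) →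
      Q.entropy E₀ Δ / 6 - (2 / 3 * |β| * |Δ| + 4 / 3 * Real.log (2 * c * (N + 1))) ≤
        2 * Real.log (2 ^ (d + 2 * k) / codeError k d (Q.codeSpace s o)) -
          Q.entropy E₀ Δ / 2} := by
  have hσ : 0 < 2 * Q.fluctuationBound E₀ Δ β c := mul_pos two_pos (mul_pos hc (Real.exp_pos _))
  have hunits (a : ℕ) (x y : window N d a → Fin 2) : Q.IsThermal P (Q.shell E₀ Δ)
      (ENNReal.ofReal (2 * Q.fluctuationBound E₀ Δ β c))
      (ampliation (splitConf (window N d a)) (single x y 1)) := by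
    rw [ENNReal.ofReal_mul zero_le_two, ENNReal.ofReal_ofNat]
    exact h.isThermal_of_supportedOn (supportedOn_iff_exists_ampliation.mpr ⟨_, rfl⟩)
      (l2_opNorm_ampliation_single_one_le _ x y)
  refine (prob_codeError_le hσ hunits s hs).trans (measure_mono fun o ho hε => ?_)
  have hlog := neg_log_le_two_mul_log_div hε (by positivity) (Q.codeError_codeSpace_le_one s o) ho
  have hx : Real.log ((N + 1) * (2 * Q.fluctuationBound E₀ Δ β c)) =
      Real.log (2 * c * (N + 1)) + (|β| * |Δ| / 2 - Q.entropy E₀ Δ / 2) := by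
    rw [← Real.log_exp (|β| * |Δ| / 2 - _), ← Real.log_mul (by positivity) (Real.exp_ne_zero _),
      fluctuationBound]
    ring_nf
  rw [hx] at hlog
  linarith

end Ensemble

end ChaosCode

theorem theorem2_general
    (N : ℕ → ℕ) (hN : Tendsto N atTop atTop)
    (Ω : ℕ → Type*) [∀ n, MeasurableSpace (Ω n)]
    (P : ∀ n, Measure (Ω n)) [∀ n, IsProbabilityMeasure (P n)]
    (Q : ∀ n, ChaosCode.Ensemble (N n) (Ω n))
    (E₀ Δ : ℕ → ℝ)
    (hΔ : Δ =o[atTop] fun n => (N n : ℝ))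
    (hS : (fun n => (N n : ℝ)) =O[atTop] fun n => (Q n).entropy (E₀ n) (Δ n))
    (d : ℕ → ℕ) (β c : ℝ)
    (hETH : ∀ n, (Q n).SatisfiesETH (P n) (d n) (E₀ n) (Δ n) β c)
    (lam : ℝ) (hlam : 0 < lam)
    (k : ℕ → ℕ) (s : ∀ n, Fin (2 ^ k n) ↪ ChaosCode.Conf (N n))
    (hs : ∀ n r, s n r ∈ (Q n).shell (E₀ n) (Δ n)) :
    Tendsto (fun n => P n {o | ∀ r r' : Fin (2 ^ k n),
        let w : ℝ := (Q n).E (s n r) - (Q n).E (s n r')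
        let S : ℝ := (Q n).entropy (E₀ n) (Δ n)
        let ε : ℝ := ChaosCode.codeError (k n) (d n) ((Q n).codeSpace (s n) o)
        0 < ε →
          0 < 2 * Real.log (2 ^ (d n + 2 * k n) / ε) - S / 2 ∧
          Real.pi * |w| / (2 * Real.log (2 ^ (d n + 2 * k n) / ε) - S / 2) ≤ lam})
      atTop (𝓝 1) := by
  have hc : 0 < |c| + 1 := by positivity
  have hprob (n : ℕ) := ((hETH n).mono ((le_abs_self c).trans (lt_add_one _).le)
    ).prob_le_log_div_codeError hc (s n) (hs n)
  have hlarge := ChaosCode.eventually_subextensive_lt hN hΔ hS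
    (fun n => (Q n).entropy_nonneg (E₀ n) (Δ n)) (2 * Real.pi / lam + 2 / 3 * |β|) (4 / 3)
    (mul_pos two_pos hc) (show (0 : ℝ) < 1 / 6 by norm_num)
  refine ChaosCode.tendsto_measure_one_of_eventually_ge hN ?_
  filter_upwards [hlarge] with n hn
  refine (hprob n).trans (measure_mono ?_)
  intro o ho r r' w S ε hε
  have hlog := ho hε
  have hw : |w| ≤ 2 * |Δ n| := ChaosCode.Ensemble.abs_sub_le_of_mem_shell (hs n r) (hs n r')
  have hD : 2 * Real.pi / lam * |Δ n| < 2 * Real.log (2 ^ (d n + 2 * k n) / ε) - S / 2 := by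
    linarith
  exact ChaosCode.pos_and_pi_mul_abs_div_le hlam hw hD

theorem theorem2
    -- a sequence of random Hamiltonians on `N n` qubits, `N n → ∞`
    (N : ℕ → ℕ) (hN : Tendsto N atTop atTop)
    (Ω : ℕ → Type*) [∀ n, MeasurableSpace (Ω n)]
    (P : ∀ n, Measure (Ω n)) [∀ n, IsProbabilityMeasure (P n)]
    (Q : ∀ n, ChaosCode.Ensemble (N n) (Ω n))
    -- microcanonical shells of subextensive width, with extensive entropy
    (E₀ Δ : ℕ → ℝ)
    (hΔ : Δ =o[atTop] fun n => (N n : ℝ))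
    (hS : (fun n => (N n : ℝ)) =O[atTop] fun n => (Q n).entropy (E₀ n) (Δ n))
    -- eigenstate thermalization for `d n`-local observables
    (d : ℕ → ℕ) (β c : ℝ) (hβ : 0 < β)
    (hETH : ∀ n, (Q n).SatisfiesETH (P n) (d n) (E₀ n) (Δ n) β c)
    -- the Lyapunov exponent, read off from ensemble-averaged correlators of local observables
    (A : ∀ n, ChaosCode.Op (N n)) (hA : ∀ n, ChaosCode.IsLocalObservable (d n) (A n))
    (lam : ℝ)
    (hlam : ChaosCode.IsLyapunovExponent
      (fun n t => ∫ o, ChaosCode.twoPoint ((Q n).hamiltonian o) (A n) β t ∂(P n))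
      (fun n t => ∫ o, ChaosCode.otoc ((Q n).hamiltonian o) (A n) β t ∂(P n)) lam)
    -- saturation of the chaos bound
    (hsat : lam = 2 * Real.pi / β)
    -- codes spanned by `2 ^ k n` eigenstates in the shell
    (k : ℕ → ℕ) (s : ∀ n, Fin (2 ^ k n) ↪ ChaosCode.Conf (N n))
    (hs : ∀ n r, s n r ∈ (Q n).shell (E₀ n) (Δ n)) :
    Tendsto (fun n => P n {o | ∀ r r' : Fin (2 ^ k n),
        let w : ℝ := (Q n).E (s n r) - (Q n).E (s n r')
        let S : ℝ := (Q n).entropy (E₀ n) (Δ n)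
        let ε : ℝ := ChaosCode.codeError (k n) (d n) ((Q n).codeSpace (s n) o)
        0 < ε →
          0 < 2 * Real.log (2 ^ (d n + 2 * k n) / ε) - S / 2 ∧
          Real.pi * |w| / (2 * Real.log (2 ^ (d n + 2 * k n) / ε) - S / 2) ≤ lam})
      atTop (𝓝 1) := by
  exact theorem2_general N hN Ω P Q E₀ Δ hΔ hS d β c hETH lam (by rw [hsat]; positivity) k s hs
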